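/- Let $M$ be a $3$-manifold (Hausdorff, second countable, without boundary), let $r\ge 3$, and let $f_0,f_1:M\to M$ be $C^r$ diffeomorphisms. Suppose that for $j=0,1$ the following hold. (a) $p_j$ is a fixed point of $f_j$, and on a neighborhood $U(p_j)$ of $p_j$, which is the preimage of a ball about the origin under a $C^r$ chart centred at $p_j$, the map $f_j$ is linear in that chart. The eigenvalues of $Df_j(p_j)$ are $r_je^{\pm\sqrt{-1}\,\theta_j}$ and $\lambda_j$, where $r_j>1$, $\theta_j\in\mathbb{R}\setminus\pi\mathbb{Z}$ and $0<\lambda_j<1$. (b) $q_j\ne p_j$ is a point of $W^s(p_j)\cap W^u(p_j)$ at which the curve $W^s(p_j)$ and the surface $W^u(p_j)$ have a quadratic tangency: if $\alpha$ is a regular parametrization of the curve near $q_j=\alpha(0)$ and $g=0$ is a regular equation of the surface near $q_j$ (each on the local sheet through $q_j$), then $g\circ\alpha$ vanishes at $0$ to order exactly two. (c) $q_j$ is positively associated with $p_j$: for all sufficiently large $n\in\mathbb{N}$ and any sufficiently small (depending on $n$) open arc $\alpha$ of $W^s(p_j)$ containing $q_j$, the point $f_j^n(q_j)$ and the set $f_j^{-n}(\alpha\setminus\{q_j\})$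 lie in the same component of $U(p_j)\setminus W^u_{\mathrm{loc}}(p_j)$, where $W^u_{\mathrm{loc}}(p_j)$ is the part of $U(p_j)$ corresponding in the chart to the expanding eigenplane. Suppose moreover that there is a homeomorphism $h:M\to M$ with $h\circ f_0=f_1\circ h$, $h(p_0)=p_1$ and $h(q_0)=q_1$. Then: (1) $\dfrac{\log\lambda_0}{\log r_0}=\dfrac{\log\lambda_1}{\log r_1}$; (2) $\theta_0=\theta_1 \bmod 2\pi$ or $\theta_0=-\theta_1 \bmod 2\pi$. -/

import Mathlib

open Set Filter Topology Manifold

namespace SaddleFocus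

/-- The model space of 3-manifolds. -/
abbrev E3 : Type := EuclideanSpace ℝ (Fin 3)

/-- The stable set `W^s(p)` of a point `p` for a map `g`: the points whose forward orbit converges
to `p`. The unstable set `W^u(p)` of an invertible map is the stable set of its inverse. -/
def stableSet {X : Type*} [TopologicalSpace X] (g : X → X) (p : X) : Set X :=
  {x | Tendsto (fun n : ℕ => g^[n] x) atTop (𝓝 p)}

variable {M : Type*} [TopologicalSpace M] [ChartedSpace E3 M] {k : WithTop ℕ∞}

/-- The neighbourhood `U(p)`: the part of the manifold that corresponds to the ball of radius `ε`
about the origin in the chart `φ`. -/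
def nbhd (φ : OpenPartialHomeomorph M E3) (ε : ℝ) : Set M :=
  φ.symm '' Metric.ball 0 ε

/-- `W^s_loc(p)`: the part of `U(p)` that corresponds to the stable subspace of the linear
map `A`. -/
def localStable (φ : OpenPartialHomeomorph M E3) (ε : ℝ) (A : E3 ≃L[ℝ] E3) : Set M :=
  φ.symm '' (Metric.ball 0 ε ∩ stableSet A 0)

/-- `W^u_loc(p)`: the part of `U(p)` that corresponds to the unstable subspace of the linear
map `A`. -/
def localUnstable (φ : OpenPartialHomeomorph M E3) (ε : ℝ) (A : E3 ≃L[ℝ] E3) : Set M :=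
  φ.symm '' (Metric.ball 0 ε ∩ stableSet A.symm 0)

/-- On the neighbourhood `nbhd φ ε` of `p` the diffeomorphism `f` is the linear map `A` with respect
to the `C^k` chart `φ` centred at `p`. In particular `p` is a fixed point of `f`, and `A` is the
derivative `Df(p)` in the coordinates given by `φ`. -/
structure IsLinearNear (f : M ≃ₘ^k⟮𝓡 3, 𝓡 3⟯ M) (p : M)
    (φ : OpenPartialHomeomorph M E3) (ε : ℝ) (A : E3 ≃L[ℝ] E3) : Prop where
  mem_maximalAtlas : φ ∈ IsManifold.maximalAtlas (𝓡 3) k M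
  mem_source : p ∈ φ.source
  map_self : φ p = 0
  radius_pos : 0 < ε
  ball_subset : Metric.ball 0 ε ⊆ φ.target
  linear : ∀ v ∈ Metric.ball (0 : E3) ε,
    f (φ.symm v) ∈ φ.source ∧ φ (f (φ.symm v)) = A v

/-- The complex eigenvalues of the real linear map `A`, with multiplicity, are
`ρ e^{iθ}`, `ρ e^{-iθ}`, `lam`. -/
def HasFocusEigenvalues (A : E3 ≃L[ℝ] E3) (ρ θ lam : ℝ) : Prop :=
  ((A : E3 →ₗ[ℝ] E3).charpoly.map (algebraMap ℝ ℂ)).roots =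
    {(ρ : ℂ) * Complex.exp (θ * Complex.I), (ρ : ℂ) * Complex.exp (-(θ * Complex.I)), (lam : ℂ)}

/-- The curve `C` has a quadratic tangency with the surface `S` at `q`: there are a regular `C^2`
parametrization `α` of `C` near `q = α 0` and a regular `C^2` equation `g = 0` of `S` near `q` such
that `g ∘ α` vanishes at `0` to order exactly two. -/
def IsQuadraticTangency (C S : Set M) (q : M) : Prop :=
  ∃ (α : ℝ → M) (g : M → ℝ),
    α 0 = q ∧ ContMDiffAt 𝓘(ℝ, ℝ) (𝓡 3) 2 α 0 ∧ mfderiv 𝓘(ℝ, ℝ) (𝓡 3) α 0 ≠ 0 ∧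
    (∀ᶠ s in 𝓝 (0 : ℝ), α s ∈ C) ∧
    g q = 0 ∧ ContMDiffAt (𝓡 3) 𝓘(ℝ, ℝ) 2 g q ∧ mfderiv (𝓡 3) 𝓘(ℝ, ℝ) g q ≠ 0 ∧
    (∀ᶠ x in 𝓝 q, x ∈ S ↔ g x = 0) ∧
    deriv (g ∘ α) 0 = 0 ∧ iteratedDeriv 2 (g ∘ α) 0 ≠ 0

/-- `f^{-n}(W^s_loc(p))`. For all large `n` it is, near a point `q` of `W^s(p)`, the piece of the
immersed curve `W^s(p)` through `q`. -/
def stableSheet (f : M ≃ₘ^k⟮𝓡 3, 𝓡 3⟯ M) (φ : OpenPartialHomeomorph M E3) (ε : ℝ)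
    (A : E3 ≃L[ℝ] E3) (n : ℕ) : Set M :=
  f.symm^[n] '' localStable φ ε A

/-- `f^n(W^u_loc(p))`. For all large `n` it is, near a point `q` of `W^u(p)`, the piece of the
immersed surface `W^u(p)` through `q`. -/
def unstableSheet (f : M ≃ₘ^k⟮𝓡 3, 𝓡 3⟯ M) (φ : OpenPartialHomeomorph M E3) (ε : ℝ)
    (A : E3 ≃L[ℝ] E3) (n : ℕ) : Set M :=
  f^[n] '' localUnstable φ ε A

/-- `q` is a homoclinic quadratic tangency of `p`: a point other than `p` of both `W^s(p)` and
`W^u(p)` at which these immersed submanifolds have a quadratic tangency. -/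
structure IsHomoclinicQuadraticTangency (f : M ≃ₘ^k⟮𝓡 3, 𝓡 3⟯ M) (p : M)
    (φ : OpenPartialHomeomorph M E3) (ε : ℝ) (A : E3 ≃L[ℝ] E3) (q : M) : Prop where
  ne : q ≠ p
  mem_stable : q ∈ stableSet f p
  mem_unstable : q ∈ stableSet f.symm p
  tangency : ∀ᶠ n : ℕ in atTop,
    IsQuadraticTangency (stableSheet f φ ε A n) (unstableSheet f φ ε A n) q

/-- `q` is positively associated with the fixed point: for all large `n`, every point `x ≠ q` of the
curve `W^s(p)` close enough to `q` on that curve is such that `f^{-n}(x)` lies in the component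
of `U(p) \ W^u_loc(p)` that contains `f^n(q)`. -/
def IsPositivelyAssociated (f : M ≃ₘ^k⟮𝓡 3, 𝓡 3⟯ M)
    (φ : OpenPartialHomeomorph M E3) (ε : ℝ) (A : E3 ≃L[ℝ] E3) (q : M) : Prop :=
  ∀ᶠ n : ℕ in atTop, ∀ᶠ x in 𝓝[stableSheet f φ ε A n \ {q}] q,
    f.symm^[n] x ∈ connectedComponentIn (nbhd φ ε \ localUnstable φ ε A) (f^[n] q)

/-- The standing assumptions on one diffeomorphism `f`: it is linear near the saddle-focus fixed
point `p`, with eigenvalues `ρ e^{±iθ}` and `lam`, and `q` is a homoclinic quadratic tangency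
positively associated with `p`. -/
structure IsSaddleFocusWithTangency (f : M ≃ₘ^k⟮𝓡 3, 𝓡 3⟯ M) (p q : M) (ρ θ lam : ℝ) : Prop where
  one_lt : 1 < ρ
  angle_ne : ∀ m : ℤ, θ ≠ m * Real.pi
  lam_pos : 0 < lam
  lam_lt : lam < 1
  exists_chart : ∃ (φ : OpenPartialHomeomorph M E3) (ε : ℝ) (A : E3 ≃L[ℝ] E3),
    IsLinearNear f p φ ε A ∧ HasFocusEigenvalues A ρ θ lam ∧
    IsHomoclinicQuadraticTangency f p φ ε A q ∧ IsPositivelyAssociated f φ ε A q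

end SaddleFocus

/-! Each diffeomorphism is studied in linear coordinates `(z, t)` in `ℂ × ℝ` in which it is
`(z, t) ↦ (μ z, lam t)` with `μ = r e^{iθ}`. Far along the homoclinic orbit of `q` there are points
`(0, t₀)` of the stable axis, with `t₀ > 0`, and `(z₀, 0)` of the unstable plane, and the transition
`S = f ^ (-K)` maps the first to the second. The second component `g` of `S` is a regular equation
of the unstable manifold near `(0, t₀)`. Positive association means that `g` is positive on the
stable axis near `(0, t₀)`, except at the point itself. This makes the axis tangent to `g = 0`, so
that the derivative of `g` at `(0, t₀)` is a nonzero linear form in `z` alone, and its value on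
`μ ^ (-n) z₀` is `R r ^ (-n) cos (nθ + c)`.

The preimage under `f ^ n` of the stable arc through `(z₀, 0)` is a hairpin near the stable axis,
over a neighbourhood of `μ ^ (-n) z₀`. If the cosine is negative, bounded away from zero, the
hairpin crosses `g = 0`, by the intermediate value theorem; if it is positive, bounded away from
zero, `g` is positive on the hairpin and there is no crossing. A further passage of length `m` makes
the unstable manifold return as sheets on which `g` is about `lam ^ m t₀`. In the second case the
hairpin meets such a sheet only if `lam ^ m` is at least of the order of `r ^ (-n)`, while for every
`n` it does meet one if `lam ^ m` is large compared with `r ^ (-n)` and the cosine for `m` is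
negative, bounded away from zero. These facts are `IsPositiveTransition.exists_profile`.

Whether such crossings exist is a statement about homoclinic orbits with prescribed itineraries
(`SingleReturn`, `DoubleReturn`), formulated with orbits that stay in a neighbourhood of `p` instead
of invariant manifolds. Hence it is transported by the conjugacy. The single returns give the sign
pattern of `cos (nθ + c)`, apart from the `n` for which the cosine is small, and the pattern
determines `θ` up to sign modulo `2π` (`angle_eq_of_sign_pattern`). The thresholds for double returns
compare `lam ^ m` with `r ^ (-n)` for both maps simultaneously, and determine `log lam / log r`
(`log_div_log_le`). -/

/-! ### Sign patterns of rotations -/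

namespace SaddleFocus

/-- Up to sign and multiples of `2π` an angle outside `πℤ` lies in `(0, π)`. -/
lemma exists_reduced_angle {θ : ℝ} (hθ : ∀ m : ℤ, θ ≠ m * Real.pi) :
    ∃ τ ∈ Ioo 0 Real.pi, ((∃ m : ℤ, θ = τ + m * (2 * Real.pi)) ∨
      ∃ m : ℤ, θ = -τ + m * (2 * Real.pi)) := by
  have hpi := Real.pi_pos
  set j : ℤ := ⌊θ / (2 * Real.pi)⌋ with hj
  have h1 : (j : ℝ) * (2 * Real.pi) ≤ θ := by
    have := Int.floor_le (θ / (2 * Real.pi))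
    rwa [le_div_iff₀ (by positivity)] at this
  have h2 : θ < (j + 1) * (2 * Real.pi) := by
    have := Int.lt_floor_add_one (θ / (2 * Real.pi))
    rwa [div_lt_iff₀ (by positivity)] at this
  have h3 : θ ≠ j * (2 * Real.pi) := by
    have := hθ (2 * j); push_cast at this; intro h; apply this; linarith
  have h4 : θ ≠ j * (2 * Real.pi) + Real.pi := by
    have := hθ (2 * j + 1); push_cast at this; intro h; apply this; linarith
  rcases lt_or_gt_of_ne h4 with h | h
  · refine ⟨θ - j * (2 * Real.pi), ⟨?_, by linarith⟩, Or.inl ⟨j, by ring⟩⟩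
    have := lt_of_le_of_ne h1 (Ne.symm h3); linarith
  · exact ⟨(j + 1) * (2 * Real.pi) - θ, ⟨by linarith, by linarith⟩,
      Or.inr ⟨j + 1, by push_cast; ring⟩⟩

/-- The sequence `cos (nθ + c)` depends on `θ` up to sign and multiples of `2π` only, after a
change of `c`. -/
lemma exists_cos_phase {θ τ : ℝ} (h : (∃ m : ℤ, θ = τ + m * (2 * Real.pi)) ∨
    ∃ m : ℤ, θ = -τ + m * (2 * Real.pi)) (c : ℝ) :
    ∃ c' : ℝ, ∀ n : ℕ, Real.cos (n * θ + c) = Real.cos (n * τ + c') := by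
  rcases h with ⟨m, rfl⟩ | ⟨m, rfl⟩
  · refine ⟨c, fun n => ?_⟩
    rw [← Real.cos_add_int_mul_two_pi (n * τ + c) (n * m)]
    congr 1; push_cast; ring
  · refine ⟨-c, fun n => ?_⟩
    rw [← Real.cos_neg (n * τ + -c), ← Real.cos_add_int_mul_two_pi (-(n * τ + -c)) (n * m)]
    congr 1; push_cast; ring

lemma sin_le_sin_of_mem_Icc {d x : ℝ} (hd0 : 0 ≤ d) (hd : d ≤ Real.pi / 2)
    (hx : x ∈ Icc d (Real.pi - d)) : Real.sin d ≤ Real.sin x := by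
  rcases le_total x (Real.pi / 2) with h | h
  · exact Real.sin_le_sin_of_le_of_le_pi_div_two (by linarith) h hx.1
  · rw [← Real.sin_pi_sub x]
    exact Real.sin_le_sin_of_le_of_le_pi_div_two (by linarith) (by linarith) (by linarith [hx.2])

/-- If a proposition `b` is decided by the sign of `sin y` whenever `|sin y| ≥ sin d`, then `b` is
the parity of the index of a half-turn that contains `y` up to an error `d`. -/
lemma exists_halfturn_index {d y : ℝ} {b : Prop} (hd0 : 0 < d) (hd : d < Real.pi / 2)
    (hpos : Real.sin d ≤ Real.sin y → ¬ b) (hneg : Real.sin y ≤ -Real.sin d → b) :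
    ∃ k : ℤ, k * Real.pi - d < y ∧ y < (k + 1) * Real.pi + d ∧ (b ↔ Odd k) := by
  have hpi := Real.pi_pos
  set k : ℤ := ⌊y / Real.pi⌋ with hk
  have h1 : (k : ℝ) * Real.pi ≤ y := by
    have := Int.floor_le (y / Real.pi)
    rwa [le_div_iff₀ hpi] at this
  have h2 : y < (k + 1) * Real.pi := by
    have := Int.lt_floor_add_one (y / Real.pi)
    rwa [div_lt_iff₀ hpi] at this
  by_cases hb : b ↔ Odd k
  · exact ⟨k, by linarith, by linarith, hb⟩
  have hsin : Real.sin y = (-1) ^ k * Real.sin (y - k * Real.pi) := by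
    rw [← Real.sin_add_int_mul_pi, sub_add_cancel]
  have hnot : ¬ (y - k * Real.pi ∈ Icc d (Real.pi - d)) := by
    intro hmem
    have hle := sin_le_sin_of_mem_Icc hd0.le hd.le hmem
    apply hb
    rcases Int.even_or_odd k with he | ho
    · rw [he.neg_one_zpow, one_mul] at hsin
      have : ¬ b := hpos (by linarith)
      have h' : ¬ Odd k := Int.not_odd_iff_even.mpr he
      tauto
    · rw [ho.neg_one_zpow, neg_one_mul] at hsin
      have : b := hneg (by linarith)
      tauto
  by_cases hlt : y - k * Real.pi < d
  · refine ⟨k - 1, by push_cast; linarith, by push_cast; linarith, ?_⟩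
    have : Odd (k - 1) ↔ ¬ Odd k := by
      rw [Int.odd_sub]; simp
    tauto
  · have : Real.pi - d < y - k * Real.pi := by
      by_contra hcon; exact hnot ⟨not_lt.mp hlt, not_lt.mp hcon⟩
    refine ⟨k + 1, by push_cast; linarith, by push_cast; linarith, ?_⟩
    have : Odd (k + 1) ↔ ¬ Odd k := by
      rw [Int.odd_add]; simp
    tauto

/-- An angle in `(0, π)` is determined by the sign pattern of `cos (nτ + c)`, even if the signs are
arbitrary where the cosine is small: between consecutive `n` the index of the half-turn increases
by `0` or `1`, so that its parity determines it up to a constant. -/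
lemma angle_eq_of_sign_pattern {τ₀ τ₁ d c₀ c₁ : ℝ} {b : ℕ → Prop} {n₀ : ℕ} (hd : 0 < d)
    (h₀ : 2 * d < τ₀) (h₀' : 2 * d < Real.pi - τ₀) (h₁ : 2 * d < τ₁) (h₁' : 2 * d < Real.pi - τ₁)
    (hp₀ : ∀ n ≥ n₀, Real.sin d ≤ Real.cos (n * τ₀ + c₀) → ¬ b n)
    (hn₀ : ∀ n ≥ n₀, Real.cos (n * τ₀ + c₀) ≤ -Real.sin d → b n)
    (hp₁ : ∀ n ≥ n₀, Real.sin d ≤ Real.cos (n * τ₁ + c₁) → ¬ b n)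
    (hn₁ : ∀ n ≥ n₀, Real.cos (n * τ₁ + c₁) ≤ -Real.sin d → b n) : τ₀ = τ₁ := by
  have hpi := Real.pi_pos
  have key : ∀ τ c : ℝ, 2 * d < τ → 2 * d < Real.pi - τ →
      (∀ n ≥ n₀, Real.sin d ≤ Real.cos (n * τ + c) → ¬ b n) →
      (∀ n ≥ n₀, Real.cos (n * τ + c) ≤ -Real.sin d → b n) →
      ∃ k : ℕ → ℤ, (∀ i, (k i : ℝ) * Real.pi - d < (n₀ + i : ℕ) * τ + c + Real.pi / 2 ∧
        (n₀ + i : ℕ) * τ + c + Real.pi / 2 < (k i + 1) * Real.pi + d) ∧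
        (∀ i, b (n₀ + i) ↔ Odd (k i)) ∧ ∀ i, k (i + 1) = k i ∨ k (i + 1) = k i + 1 := by
    intro τ c hτ hτ' hp hn
    have : ∀ i : ℕ, ∃ k : ℤ, (k : ℝ) * Real.pi - d < (n₀ + i : ℕ) * τ + c + Real.pi / 2 ∧
        (n₀ + i : ℕ) * τ + c + Real.pi / 2 < (k + 1) * Real.pi + d ∧ (b (n₀ + i) ↔ Odd k) := by
      intro i
      refine exists_halfturn_index hd (by linarith) ?_ ?_
      · rw [Real.sin_add_pi_div_two]; exact hp _ (by omega)
      · rw [Real.sin_add_pi_div_two]; exact hn _ (by omega)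
    choose k hk using this
    refine ⟨k, fun i => ⟨(hk i).1, (hk i).2.1⟩, fun i => (hk i).2.2, fun i => ?_⟩
    obtain ⟨a1, a2, -⟩ := hk i
    obtain ⟨b1, b2, -⟩ := hk (i + 1)
    push_cast at a1 a2 b1 b2
    have e1 : (k (i + 1) : ℝ) < k i + 2 := by
      by_contra hcon
      have : ((k i : ℝ) + 2) * Real.pi ≤ k (i + 1) * Real.pi :=
        mul_le_mul_of_nonneg_right (not_lt.mp hcon) hpi.le
      linarith
    have e2 : (k i : ℝ) < k (i + 1) + 1 := by
      by_contra hcon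
      have : ((k (i + 1) : ℝ) + 1) * Real.pi ≤ k i * Real.pi :=
        mul_le_mul_of_nonneg_right (not_lt.mp hcon) hpi.le
      linarith
    have e1' : k (i + 1) < k i + 2 := by exact_mod_cast e1
    have e2' : k i < k (i + 1) + 1 := by exact_mod_cast e2
    omega
  obtain ⟨k, hk, hkb, hks⟩ := key τ₀ c₀ h₀ h₀' hp₀ hn₀
  obtain ⟨l, hl, hlb, hls⟩ := key τ₁ c₁ h₁ h₁' hp₁ hn₁
  have hconst : ∀ i, k i - l i = k 0 - l 0 := by
    intro i
    induction i with
    | zero => rfl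
    | succ i ih =>
      have p1 : Odd (k i) ↔ Odd (l i) := (hkb i).symm.trans (hlb i)
      have p2 : Odd (k (i + 1)) ↔ Odd (l (i + 1)) := (hkb _).symm.trans (hlb _)
      rw [Int.odd_iff, Int.odd_iff] at p1 p2
      have := hks i; have := hls i
      omega
  have hbound : ∀ i : ℕ, |(i : ℝ) * (τ₀ - τ₁)| ≤
      |((k 0 : ℝ) - l 0) * Real.pi| + Real.pi + 2 * d + |n₀ * (τ₀ - τ₁) + c₀ - c₁| := by
    intro i
    have e : ((k i : ℝ) - l i) = k 0 - l 0 := by exact_mod_cast hconst i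
    obtain ⟨a1, a2⟩ := hk i
    obtain ⟨b1, b2⟩ := hl i
    push_cast at a1 a2 b1 b2
    have e' : (k i : ℝ) * Real.pi = l i * Real.pi + ((k 0 : ℝ) - l 0) * Real.pi := by
      rw [← e]; ring
    have f1 := abs_le.mp (le_refl |((k 0 : ℝ) - l 0) * Real.pi|)
    have f2 := abs_le.mp (le_refl |n₀ * (τ₀ - τ₁) + c₀ - c₁|)
    rw [abs_le]; constructor <;> nlinarith
  by_contra hne
  have hpos : 0 < |τ₀ - τ₁| := abs_pos.mpr (sub_ne_zero.mpr hne)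
  obtain ⟨i, hi⟩ := exists_nat_gt ((|((k 0 : ℝ) - l 0) * Real.pi| + Real.pi + 2 * d +
    |n₀ * (τ₀ - τ₁) + c₀ - c₁|) / |τ₀ - τ₁|)
  rw [div_lt_iff₀ hpos] at hi
  have := hbound i
  rw [abs_mul, Nat.abs_cast] at this
  linarith

/-- The times at which `cos (nτ + c)` is bounded below by `sin d` have bounded gaps. -/
lemma exists_le_cos {τ d : ℝ} (hd : 0 < d) (h : 2 * d < τ) (h' : 2 * d < Real.pi - τ) (c : ℝ) :
    ∃ L : ℕ, ∀ n₀ : ℕ, ∃ n, n₀ ≤ n ∧ n ≤ n₀ + L ∧ Real.sin d ≤ Real.cos (n * τ + c) := by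
  have hpi := Real.pi_pos
  have hτ : 0 < τ := by linarith
  refine ⟨⌈3 * Real.pi / τ⌉₊, fun n₀ => ?_⟩
  set y : ℝ := n₀ * τ + c + Real.pi / 2 with hy
  set j : ℤ := ⌈y / (2 * Real.pi)⌉ with hj
  have h1 : y ≤ j * (2 * Real.pi) := by
    have := Int.le_ceil (y / (2 * Real.pi))
    rwa [div_le_iff₀ (by positivity)] at this
  have h2 : (j : ℝ) * (2 * Real.pi) < y + 2 * Real.pi := by
    have := Int.ceil_lt_add_one (y / (2 * Real.pi))
    rw [← hj, div_add_one (by positivity), lt_div_iff₀ (by positivity)] at this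
    exact this
  set i : ℕ := ⌈(j * (2 * Real.pi) + d - y) / τ⌉₊ with hi
  have h3 : j * (2 * Real.pi) + d - y ≤ i * τ := by
    have := Nat.le_ceil ((j * (2 * Real.pi) + d - y) / τ)
    rwa [div_le_iff₀ hτ] at this
  have h4 : i * τ < j * (2 * Real.pi) + d - y + τ := by
    have := Nat.ceil_lt_add_one (a := (j * (2 * Real.pi) + d - y) / τ)
      (div_nonneg (by linarith) hτ.le)
    rw [← hi, div_add_one hτ.ne', lt_div_iff₀ hτ] at this
    exact this
  refine ⟨n₀ + i, by omega, ?_, ?_⟩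
  · have : i ≤ ⌈3 * Real.pi / τ⌉₊ :=
      Nat.ceil_mono (div_le_div_of_nonneg_right (by linarith) hτ.le)
    omega
  · have e : (((n₀ + i : ℕ) : ℝ) * τ + c) = (y + i * τ - j * (2 * Real.pi)) - Real.pi / 2
        + j * (2 * Real.pi) := by
      push_cast; rw [hy]; ring
    rw [e, Real.cos_add_int_mul_two_pi, Real.cos_sub_pi_div_two]
    exact sin_le_sin_of_mem_Icc hd.le (by linarith) ⟨by linarith, by linarith⟩

/-- If `r₁ ^ (-n) ≤ C l₁ ^ m` whenever `C r₀ ^ (-n) ≤ l₀ ^ m`, for `n` and `m` along sign patterns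
of rotations, then the exponents of the comparison are ordered. -/
lemma log_div_log_le {τ₀ τ₁ d c₀ c₁ r₀ r₁ l₀ l₁ C₀ C₁ : ℝ} {n₀ : ℕ} (hd : 0 < d)
    (h₀ : 2 * d < τ₀) (h₀' : 2 * d < Real.pi - τ₀) (h₁ : 2 * d < τ₁) (h₁' : 2 * d < Real.pi - τ₁)
    (hr₀ : 1 < r₀) (hr₁ : 1 < r₁) (hl₀ : 0 < l₀) (hl₀' : l₀ < 1) (hl₁ : 0 < l₁) (hl₁' : l₁ < 1)
    (hC₀ : 0 < C₀) (hC₁ : 0 < C₁)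
    (H : ∀ n ≥ n₀, ∀ m ≥ n₀, Real.cos (m * τ₀ + c₀) ≤ -Real.sin d → C₀ * (r₀ ^ n)⁻¹ ≤ l₀ ^ m →
      Real.sin d ≤ Real.cos (n * τ₁ + c₁) → (r₁ ^ n)⁻¹ ≤ C₁ * l₁ ^ m) :
    Real.log l₁ / Real.log r₁ ≥ Real.log l₀ / Real.log r₀ := by
  obtain ⟨L, hL⟩ := exists_le_cos hd h₀ h₀' (c₀ + Real.pi)
  obtain ⟨L', hL'⟩ := exists_le_cos hd h₁ h₁' c₁
  have R₀ : 0 < Real.log r₀ := Real.log_pos hr₀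
  have R₁ : 0 < Real.log r₁ := Real.log_pos hr₁
  have Λ₀ : Real.log l₀ < 0 := Real.log_neg hl₀ hl₀'
  have Λ₁ : Real.log l₁ < 0 := Real.log_neg hl₁ hl₁'
  set a := Real.log r₀ / (-Real.log l₀) with ha
  have ha0 : 0 < a := div_pos R₀ (by linarith)
  set e := Real.log C₀ / (-Real.log l₀) with he
  -- a bound on `n` from the existence of suitable `m` close to `n * a`
  have bound : ∀ᶠ n : ℕ in atTop, Real.sin d ≤ Real.cos (n * τ₁ + c₁) →
      n * (a * -Real.log l₁ - Real.log r₁) ≤ Real.log C₁ + (e + L + 1) * -Real.log l₁ := by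
    have hlarge : Tendsto (fun n : ℕ => (n : ℝ) * a - e) atTop atTop :=
      tendsto_atTop_add_const_right _ _ (tendsto_natCast_atTop_atTop.atTop_mul_const ha0)
    filter_upwards [eventually_ge_atTop n₀, hlarge.eventually_ge_atTop ((n₀ : ℝ) + L + 1)]
      with n hn hn' hcos
    have hx0 : 0 ≤ n * a - e - L := by
      have : (0 : ℝ) ≤ n₀ := by positivity
      linarith
    obtain ⟨m, hm1, hm2, hm3⟩ := hL ⌊n * a - e - L⌋₊
    have f1 := Nat.floor_le hx0
    have f2 := Nat.lt_floor_add_one ((n : ℝ) * a - e - L)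
    have g1 : (⌊(n : ℝ) * a - e - L⌋₊ : ℝ) ≤ m := by exact_mod_cast hm1
    have g2 : (m : ℝ) ≤ ⌊(n : ℝ) * a - e - L⌋₊ + L := by exact_mod_cast hm2
    have hmn : n₀ ≤ m := by
      have : (n₀ : ℝ) < m + 1 := by linarith
      have : n₀ < m + 1 := by exact_mod_cast this
      omega
    have hcosm : Real.cos (m * τ₀ + c₀) ≤ -Real.sin d := by
      rw [← add_assoc, Real.cos_add_pi] at hm3; linarith
    have hcond : C₀ * (r₀ ^ n)⁻¹ ≤ l₀ ^ m := by
      rw [← Real.log_le_log_iff (by positivity) (by positivity),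
        Real.log_mul (by positivity) (by positivity), Real.log_inv, Real.log_pow, Real.log_pow]
      have : (m : ℝ) ≤ n * a - e := by linarith
      have h5 : m * (-Real.log l₀) ≤ (n * a - e) * (-Real.log l₀) :=
        mul_le_mul_of_nonneg_right this (by linarith)
      have h6 : (n * a - e) * (-Real.log l₀) = n * Real.log r₀ - Real.log C₀ := by
        have hne : -Real.log l₀ ≠ 0 := by linarith
        rw [ha, he, sub_mul, mul_assoc, div_mul_cancel₀ _ hne, div_mul_cancel₀ _ hne]
      linarith
    have hres := H n hn m hmn hcosm hcond hcos
    rw [← Real.log_le_log_iff (by positivity) (by positivity),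
        Real.log_mul (by positivity) (by positivity), Real.log_inv, Real.log_pow, Real.log_pow]
      at hres
    have h7 : (n * a - e - L - 1) * (-Real.log l₁) ≤ m * (-Real.log l₁) :=
      mul_le_mul_of_nonneg_right (by linarith) (by linarith)
    linarith
  have hle : a * -Real.log l₁ - Real.log r₁ ≤ 0 := by
    by_contra hcon
    rw [not_le] at hcon
    have htend : Tendsto (fun n : ℕ => (n : ℝ) * (a * -Real.log l₁ - Real.log r₁)) atTop atTop :=
      tendsto_natCast_atTop_atTop.atTop_mul_const hcon
    obtain ⟨N, hN⟩ := eventually_atTop.mp (bound.and (htend.eventually_gt_atTop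
      (Real.log C₁ + (e + L + 1) * -Real.log l₁)))
    obtain ⟨n, hn, -, hcos⟩ := hL' N
    have := (hN n hn).1 hcos
    linarith [(hN n hn).2]
  rw [ge_iff_le, div_le_div_iff₀ R₀ R₁]
  have h8 : a * -Real.log l₁ * (-Real.log l₀) ≤ Real.log r₁ * (-Real.log l₀) :=
    mul_le_mul_of_nonneg_right (by linarith) (by linarith)
  have h9 : a * -Real.log l₁ * (-Real.log l₀) = Real.log r₀ * -Real.log l₁ := by
    have hne : -Real.log l₀ ≠ 0 := by linarith
    rw [ha, mul_right_comm, div_mul_cancel₀ _ hne]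
  linarith

end SaddleFocus

/-! ### The linear normal form of a saddle-focus -/

namespace SaddleFocus

/-- A complex root of the characteristic polynomial of a real endomorphism gives the real and
imaginary parts `a`, `b` of a complex eigenvector. -/
lemma exists_re_im_eigenvector {E : Type*} [AddCommGroup E] [Module ℝ E] [FiniteDimensional ℝ E]
    (A : E →ₗ[ℝ] E) {μ : ℂ} (hμ : (A.charpoly.map (algebraMap ℝ ℂ)).IsRoot μ) :
    ∃ a b : E, (a ≠ 0 ∨ b ≠ 0) ∧ A a = μ.re • a - μ.im • b ∧ A b = μ.im • a + μ.re • b := by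
  classical
  let B := Module.finBasis ℝ E
  have hdet : (Matrix.scalar (Fin (Module.finrank ℝ E)) μ -
      (LinearMap.toMatrix B B A).map (algebraMap ℝ ℂ)).det = 0 := by
    rw [← LinearMap.charpoly_toMatrix A B, ← Matrix.charpoly_map, Polynomial.IsRoot.def,
      Matrix.eval_charpoly] at hμ
    exact hμ
  obtain ⟨v, hv0, hv⟩ := Matrix.exists_mulVec_eq_zero_iff.mpr hdet
  have hv' : ∀ i, ∑ j, ((LinearMap.toMatrix B B A i j : ℝ) : ℂ) * v j = μ * v i := by
    intro i
    have := congrFun hv i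
    rw [Matrix.sub_mulVec, Pi.sub_apply, Pi.zero_apply, sub_eq_zero] at this
    rw [Matrix.scalar_apply, Matrix.mulVec_diagonal] at this
    exact this.symm
  have hA : ∀ w : Fin (Module.finrank ℝ E) → ℝ, ∀ i,
      B.repr (A (∑ j, w j • B j)) i = ∑ j, LinearMap.toMatrix B B A i j * w j := by
    intro w i
    have := congrFun (LinearMap.toMatrix_mulVec_repr B B A (∑ j, w j • B j)) i
    rw [← this, Matrix.mulVec, dotProduct]
    simp only [B.repr_sum_self]
  have hrepr : ∀ w : Fin (Module.finrank ℝ E) → ℝ, ∀ i, B.repr (∑ j, w j • B j) i = w i :=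
    fun w i => congrFun (B.repr_sum_self w) i
  refine ⟨∑ j, (v j).re • B j, ∑ j, (v j).im • B j, ?_, ?_, ?_⟩
  · by_contra hcon
    push Not at hcon
    apply hv0
    funext j
    have h1 := hrepr (fun j => (v j).re) j
    have h2 := hrepr (fun j => (v j).im) j
    simp only [hcon.1, hcon.2, map_zero, Finsupp.coe_zero, Pi.zero_apply] at h1 h2
    exact Complex.ext h1.symm h2.symm
  · apply B.repr.injective
    ext i
    have := congrArg Complex.re (hv' i)
    simp only [Complex.re_sum, Complex.mul_re, Complex.ofReal_re, Complex.ofReal_im, zero_mul,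
      sub_zero] at this
    rw [hA, this]
    simp only [map_sub, map_smul, Finsupp.sub_apply, Finsupp.smul_apply, hrepr, smul_eq_mul]
  · apply B.repr.injective
    ext i
    have := congrArg Complex.im (hv' i)
    simp only [Complex.im_sum, Complex.mul_im, Complex.ofReal_re, Complex.ofReal_im, zero_mul,
      add_zero] at this
    rw [hA, this]
    simp only [map_add, map_smul, Finsupp.add_apply, Finsupp.smul_apply, hrepr, smul_eq_mul]
    ring

/-- The linear model of a saddle-focus: `(z, t) ↦ (μ z, lam t)`. -/
def focusMap (μ : ℂ) (lam : ℝ) (v : ℂ × ℝ) : ℂ × ℝ := (μ * v.1, lam * v.2)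

/-- A real linear map with eigenvalues `μ`, `conj μ`, `lam`, where `μ` is not real, is conjugate to
the linear model. -/
lemma exists_linear_normal_form (A : E3 ≃L[ℝ] E3) {ρ θ lam : ℝ}
    (hA : HasFocusEigenvalues A ρ θ lam)
    (him : ((ρ : ℂ) * Complex.exp (θ * Complex.I)).im ≠ 0) :
    ∃ L : E3 ≃L[ℝ] ℂ × ℝ, ∀ v, L (A v) = focusMap (ρ * Complex.exp (θ * Complex.I)) lam (L v) := by
  set μ : ℂ := ρ * Complex.exp (θ * Complex.I) with hμ
  have hr1 : ((A : E3 →ₗ[ℝ] E3).charpoly.map (algebraMap ℝ ℂ)).IsRoot μ := by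
    refine (Polynomial.mem_roots'.mp ?_).2
    rw [hA]; simp [hμ]
  have hr2 : ((A : E3 →ₗ[ℝ] E3).charpoly.map (algebraMap ℝ ℂ)).IsRoot (lam : ℂ) := by
    refine (Polynomial.mem_roots'.mp ?_).2
    rw [hA]; simp
  obtain ⟨a, b, hab, hAa, hAb⟩ := exists_re_im_eigenvector _ hr1
  obtain ⟨w, hw0, hw⟩ : ∃ w : E3, w ≠ 0 ∧ A w = lam • w := by
    obtain ⟨a, b, hab, hAa, hAb⟩ := exists_re_im_eigenvector _ hr2
    rcases hab with h | h
    · exact ⟨a, h, by simpa using hAa⟩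
    · exact ⟨b, h, by simpa using hAb⟩
  let P : ℂ × ℝ →ₗ[ℝ] E3 :=
    { toFun := fun v => v.1.re • a - v.1.im • b + v.2 • w
      map_add' := fun x y => by simp; module
      map_smul' := fun c x => by simp; module }
  have hP : ∀ v, P v = v.1.re • a - v.1.im • b + v.2 • w := fun _ => rfl
  have hcomm : ∀ v, P (focusMap μ lam v) = A (P v) := by
    intro v
    have e1 : A a = μ.re • a - μ.im • b := hAa
    have e2 : A b = μ.im • a + μ.re • b := hAb
    rw [hP, hP, map_add, map_sub, map_smul, map_smul, map_smul, e1, e2, hw]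
    simp only [focusMap, Complex.mul_re, Complex.mul_im]
    module
  have hinj : Function.Injective P := by
    rw [← LinearMap.ker_eq_bot, LinearMap.ker_eq_bot']
    intro v hv
    have hz0 : ∀ v : ℂ × ℝ, P v = 0 → v.1 = 0 := by
      intro v hv
      by_contra hz
      -- the kernel contains `(u, 0)` for all multiples `u` of `y`, hence the whole plane
      set y : ℂ := (μ - lam) * v.1 with hy
      have hy0 : y ≠ 0 := by
        refine mul_ne_zero (fun h => him ?_) hz
        rw [sub_eq_zero.mp h, Complex.ofReal_im]
      have hstep : ∀ z : ℂ, P (z, 0) = 0 → P (μ * z, 0) = 0 := by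
        intro z h
        have := hcomm (z, 0)
        rw [h, map_zero] at this
        simpa [focusMap] using this
      have hPy : P (y, 0) = 0 := by
        have h1 := hcomm v
        rw [hv, map_zero] at h1
        have h2 : (y, (0 : ℝ)) = focusMap μ lam v - lam • v := by
          ext <;> simp [focusMap, hy, sub_mul]
        rw [h2, map_sub, map_smul, h1, hv, smul_zero, sub_zero]
      have hPμ := hstep y hPy
      have hall : ∀ c : ℂ, P (c * y, 0) = 0 := by
        intro c
        have : (c * y, (0 : ℝ)) = (c.im / μ.im) • ((μ * y, 0) : ℂ × ℝ) +
            (c.re - c.im / μ.im * μ.re) • (y, 0) := by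
          have hc : c = (c.im / μ.im : ℝ) * μ + (c.re - c.im / μ.im * μ.re : ℝ) := by
            apply Complex.ext
            · simp
            · simp [div_mul_cancel₀ _ him]
          refine Prod.ext ?_ ?_
          · conv_lhs => rw [hc]
            simp only [Prod.fst_add, Prod.smul_fst, Complex.real_smul]
            ring
          · simp
        rw [this, map_add, map_smul, map_smul, hPμ, hPy]; simp
      have ha : P (1, 0) = 0 := by simpa [inv_mul_cancel₀ hy0] using hall (y⁻¹)
      have hb : P (Complex.I, 0) = 0 := by
        simpa [mul_assoc, inv_mul_cancel₀ hy0] using hall (Complex.I * y⁻¹)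
      rw [hP] at ha hb
      simp at ha hb
      tauto
    have h1 := hz0 v hv
    have h2 : v.2 • w = 0 := by
      rw [hP, h1] at hv; simpa using hv
    exact Prod.ext h1 ((smul_eq_zero.mp h2).resolve_right hw0)
  have hdim : Module.finrank ℝ (ℂ × ℝ) = Module.finrank ℝ E3 := by
    simp [Module.finrank_prod]
  let e := (LinearEquiv.ofInjectiveOfFinrankEq P hinj hdim).toContinuousLinearEquiv
  have he : ∀ v, e v = P v := fun v => rfl
  refine ⟨e.symm, fun v => ?_⟩
  apply e.injective
  rw [e.apply_symm_apply, he, hcomm, ← he, e.apply_symm_apply]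

end SaddleFocus

/-! ### Transitions along a homoclinic orbit in the linear model -/

namespace SaddleFocus

lemma focusMap_iterate (μ : ℂ) (lam : ℝ) (n : ℕ) (v : ℂ × ℝ) :
    (focusMap μ lam)^[n] v = (μ ^ n * v.1, lam ^ n * v.2) := by
  induction n with
  | zero => simp
  | succ n ih =>
    rw [Function.iterate_succ_apply', ih]
    simp only [focusMap, pow_succ']
    ext1 <;> ring

/-- The backward transition `S` from a point `(0, t₀)` of the stable axis to a point `(z₀, 0)` of
the unstable plane. Its second component is a regular equation `(S p).2 = 0` of the unstable
manifold near `(0, t₀)`, and it is positive on the stable axis away from `(0, t₀)`. -/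
structure IsPositiveTransition (S : ℂ × ℝ → ℂ × ℝ) (z₀ : ℂ) (t₀ : ℝ) (G : ℂ × ℝ →L[ℝ] ℝ) :
    Prop where
  ne_zero : z₀ ≠ 0
  pos : 0 < t₀
  map_eq : S (0, t₀) = (z₀, 0)
  continuousAt : ∀ᶠ p in 𝓝 ((0 : ℂ), t₀), ContinuousAt S p
  strict : HasStrictFDerivAt (fun p => (S p).2) G (0, t₀)
  deriv_ne : G ≠ 0
  height_pos : ∀ᶠ t in 𝓝 t₀, t ≠ t₀ → 0 < (S (0, t)).2

namespace IsPositiveTransition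

variable {S : ℂ × ℝ → ℂ × ℝ} {z₀ : ℂ} {t₀ : ℝ} {G : ℂ × ℝ →L[ℝ] ℝ}

/-- A one-sided contact is a tangency. -/
lemma deriv_axis_eq_zero (hS : IsPositiveTransition S z₀ t₀ G) : G (0, 1) = 0 := by
  have hmin : IsLocalMin (fun t : ℝ => (S (0, t)).2) t₀ := by
    filter_upwards [hS.height_pos] with t ht
    rw [hS.map_eq]
    rcases eq_or_ne t t₀ with rfl | h
    · rw [hS.map_eq]
    · exact (ht h).le
  have hline : HasDerivAt (fun t : ℝ => ((0 : ℂ), t)) (0, 1) t₀ :=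
    (hasDerivAt_const t₀ (0 : ℂ)).prodMk (hasDerivAt_id t₀)
  exact hmin.hasDerivAt_eq_zero (hS.strict.hasFDerivAt.comp_hasDerivAt t₀ hline)

lemma deriv_apply (hS : IsPositiveTransition S z₀ t₀ G) (p : ℂ × ℝ) : G p = G (p.1, 0) := by
  have : p = (p.1, 0) + p.2 • ((0 : ℂ), (1 : ℝ)) := by ext1 <;> simp
  conv_lhs => rw [this, map_add, map_smul, hS.deriv_axis_eq_zero, smul_zero, add_zero]

/-- The linear part of the equation along the spiral `μ ^ (-n) z₀` is a damped oscillation. -/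
lemma exists_phase (hS : IsPositiveTransition S z₀ t₀ G) {μ : ℂ} {r θ : ℝ}
    (hμ : μ = r * Complex.exp (θ * Complex.I)) :
    ∃ R > 0, ∃ c : ℝ, ∀ n : ℕ, G ((μ ^ n)⁻¹ * z₀, 0) = R * (r ^ n)⁻¹ * Real.cos (n * θ + c) := by
  set κ : ℂ := ⟨G (1, 0), -G (Complex.I, 0)⟩ with hκ
  have hG : ∀ z : ℂ, G (z, 0) = (κ * z).re := by
    intro z
    have : (z, (0 : ℝ)) = z.re • ((1 : ℂ), (0 : ℝ)) + z.im • (Complex.I, (0 : ℝ)) := by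
      ext1
      · simp [Complex.re_add_im]
      · simp
    rw [this, map_add, map_smul, map_smul]
    simp [hκ]; ring
  have hκ0 : κ ≠ 0 := by
    intro h
    apply hS.deriv_ne
    refine ContinuousLinearMap.ext fun p => ?_
    rw [hS.deriv_apply, hG, h]; simp
  have hω : κ * z₀ ≠ 0 := mul_ne_zero hκ0 hS.ne_zero
  refine ⟨‖κ * z₀‖, norm_pos_iff.mpr hω, -Complex.arg (κ * z₀), fun n => ?_⟩
  rw [hG]
  have e1 : (μ ^ n)⁻¹ = ((r ^ n)⁻¹ : ℝ) * Complex.exp (((-(n * θ) : ℝ)) * Complex.I) := by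
    rw [hμ, mul_pow, ← Complex.exp_nat_mul, mul_inv, ← Complex.exp_neg]
    push_cast; congr 2; ring
  have e2 : κ * ((μ ^ n)⁻¹ * z₀) = ((‖κ * z₀‖ * (r ^ n)⁻¹ : ℝ) : ℂ) *
      Complex.exp (((-(n * θ) + Complex.arg (κ * z₀) : ℝ)) * Complex.I) := by
    rw [mul_left_comm, e1, Complex.ofReal_add, add_mul, Complex.exp_add]
    conv_lhs => rw [← Complex.norm_mul_exp_arg_mul_I (κ * z₀)]
    push_cast
    ring
  rw [e2, Complex.re_ofReal_mul, Complex.exp_ofReal_mul_I_re, ← Real.cos_neg]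
  congr 2; ring

/-- The size of the equation at points over the spiral `μ ^ (-n) z₀`, uniformly in `n`. -/
lemma exists_height_estimate (hS : IsPositiveTransition S z₀ t₀ G) {μ : ℂ} {r θ R c : ℝ}
    (hr : 1 < r) (hμ : ‖μ‖ = r) (hR : ∀ n : ℕ, G ((μ ^ n)⁻¹ * z₀, 0) =
      R * (r ^ n)⁻¹ * Real.cos (n * θ + c)) {δ : ℝ} (hδ : 0 < δ) :
    ∃ ρ > 0, ρ ≤ 1 ∧ ∃ V ∈ 𝓝 ((0 : ℂ), t₀), ∀ (n : ℕ) (x : ℂ) (t : ℝ), ‖x - z₀‖ < ρ →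
      ((μ ^ n)⁻¹ * x, t) ∈ V →
      |(S ((μ ^ n)⁻¹ * x, t)).2 - (S (0, t)).2 - R * (r ^ n)⁻¹ * Real.cos (n * θ + c)|
        ≤ δ * (r ^ n)⁻¹ := by
  set η : ℝ := δ / (2 * (‖z₀‖ + 1)) with hη
  have hz : 0 < ‖z₀‖ + 1 := by positivity
  have hη0 : 0 < η := by positivity
  set ρ : ℝ := min 1 (δ / (2 * (‖G‖ + 1))) with hρ
  have hρ0 : 0 < ρ := by positivity
  have h1 := hS.strict.isLittleO.def hη0
  have htend : Tendsto (fun p : ℂ × ℝ => (p, ((0 : ℂ), p.2))) (𝓝 (0, t₀))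
      (𝓝 ((0, t₀), (0, t₀))) := by
    have : Continuous (fun p : ℂ × ℝ => (p, ((0 : ℂ), p.2))) := by fun_prop
    exact this.tendsto (0, t₀)
  have h2 := htend.eventually h1
  refine ⟨ρ, hρ0, min_le_left _ _, _, h2, fun n x t hx hV => ?_⟩
  simp only [mem_ofPred_eq] at hV
  rw [hS.deriv_apply] at hV
  simp only [Prod.mk_sub_mk, sub_zero, sub_self, Real.norm_eq_abs] at hV
  have hn : ‖(μ ^ n)⁻¹‖ = (r ^ n)⁻¹ := by rw [norm_inv, norm_pow, hμ]
  have hrn : 0 < (r ^ n)⁻¹ := by positivity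
  have hxn : ‖x‖ ≤ ‖z₀‖ + 1 := by
    have : ‖x‖ ≤ ‖z₀‖ + ‖x - z₀‖ := norm_le_norm_add_norm_sub' x z₀
    have : ρ ≤ 1 := min_le_left _ _
    linarith
  have hpair : ∀ z : ℂ, ‖(z, (0 : ℝ))‖ = ‖z‖ := fun z => by simp [Prod.norm_def]
  rw [hpair, norm_mul, hn] at hV
  have hsplit : G ((μ ^ n)⁻¹ * x, 0) = R * (r ^ n)⁻¹ * Real.cos (n * θ + c) +
      G ((μ ^ n)⁻¹ * (x - z₀), 0) := by
    rw [← hR, ← map_add]; congr 1; ext1 <;> simp; ring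
  have hG : |G ((μ ^ n)⁻¹ * (x - z₀), 0)| ≤ δ / 2 * (r ^ n)⁻¹ := by
    have := G.le_opNorm ((μ ^ n)⁻¹ * (x - z₀), 0)
    rw [hpair, norm_mul, hn, Real.norm_eq_abs] at this
    refine this.trans ?_
    have h3 : ‖G‖ * ‖x - z₀‖ ≤ δ / 2 := by
      have h4 : ‖x - z₀‖ ≤ δ / (2 * (‖G‖ + 1)) := hx.le.trans (min_le_right _ _)
      calc ‖G‖ * ‖x - z₀‖ ≤ (‖G‖ + 1) * (δ / (2 * (‖G‖ + 1))) :=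
            mul_le_mul (by linarith) h4 (norm_nonneg _) (by positivity)
        _ = δ / 2 := by field_simp
    calc ‖G‖ * ((r ^ n)⁻¹ * ‖x - z₀‖) = (‖G‖ * ‖x - z₀‖) * (r ^ n)⁻¹ := by ring
      _ ≤ _ := mul_le_mul_of_nonneg_right h3 hrn.le
  have hηx : η * ((r ^ n)⁻¹ * ‖x‖) ≤ δ / 2 * (r ^ n)⁻¹ := by
    calc η * ((r ^ n)⁻¹ * ‖x‖) ≤ η * ((r ^ n)⁻¹ * (‖z₀‖ + 1)) := by gcongr
      _ = δ / 2 * (r ^ n)⁻¹ := by rw [hη]; field_simp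
  rw [hsplit] at hV
  have := abs_le.mp (hV.trans hηx)
  have := abs_le.mp hG
  rw [abs_le]; constructor <;> linarith

end IsPositiveTransition

/-- The preimage of `x` under the `n`-th iterate of the linear model, with the height clamped to the
interval `[t₀, t₀ + η]`. -/
noncomputable def clampedPullback (μ : ℂ) (lam t₀ η : ℝ) (n : ℕ) (x : ℂ × ℝ) : ℂ × ℝ :=
  ((μ ^ n)⁻¹ * x.1, max t₀ (min (t₀ + η) ((lam ^ n)⁻¹ * x.2)))

section clampedPullback

variable {μ : ℂ} {lam t₀ η : ℝ} {n : ℕ} {x : ℂ × ℝ}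

lemma continuous_clampedPullback : Continuous (clampedPullback μ lam t₀ η n) := by
  unfold clampedPullback; fun_prop

lemma clampedPullback_snd_mem (hη : 0 ≤ η) :
    (clampedPullback μ lam t₀ η n x).2 ∈ Icc t₀ (t₀ + η) :=
  ⟨le_max_left _ _, max_le (by linarith) (min_le_left _ _)⟩

lemma clampedPullback_snd_of_le (hlam : 0 < lam) (h : x.2 ≤ lam ^ n * t₀) :
    (clampedPullback μ lam t₀ η n x).2 = t₀ := by
  refine max_eq_left ((min_le_right _ _).trans ?_)
  rwa [inv_mul_le_iff₀ (by positivity)]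

lemma clampedPullback_snd_of_ge (hlam : 0 < lam) (hη : 0 ≤ η) (h : lam ^ n * (t₀ + η) ≤ x.2) :
    (clampedPullback μ lam t₀ η n x).2 = t₀ + η := by
  have : t₀ + η ≤ (lam ^ n)⁻¹ * x.2 := by rwa [le_inv_mul_iff₀ (by positivity)]
  simp only [clampedPullback]
  rw [min_eq_left this, max_eq_right (by linarith)]

lemma iterate_clampedPullback (hμ : μ ≠ 0) (hlam : 0 < lam) (hη : 0 ≤ η)
    (h1 : (clampedPullback μ lam t₀ η n x).2 ≠ t₀)
    (h2 : (clampedPullback μ lam t₀ η n x).2 ≠ t₀ + η) :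
    (focusMap μ lam)^[n] (clampedPullback μ lam t₀ η n x) = x := by
  have hl : lam ^ n ≠ 0 := by positivity
  have hμn : μ ^ n ≠ 0 := pow_ne_zero _ hμ
  have ha : lam ^ n * t₀ < x.2 := by
    by_contra hcon; exact h1 (clampedPullback_snd_of_le hlam (not_lt.mp hcon))
  have hb : x.2 < lam ^ n * (t₀ + η) := by
    by_contra hcon; exact h2 (clampedPullback_snd_of_ge hlam hη (not_lt.mp hcon))
  have ha' : t₀ ≤ (lam ^ n)⁻¹ * x.2 := by rw [le_inv_mul_iff₀ (by positivity)]; exact ha.le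
  have hb' : (lam ^ n)⁻¹ * x.2 ≤ t₀ + η := by rw [inv_mul_le_iff₀ (by positivity)]; exact hb.le
  rw [focusMap_iterate]
  simp only [clampedPullback]
  rw [min_eq_right hb', max_eq_right ha', mul_inv_cancel_left₀ hμn, mul_inv_cancel_left₀ hl]

end clampedPullback

/-- The itineraries of homoclinic orbits in the linear model, for a transition `S`.
Necessary conditions: an orbit piece of length `n` between neighbourhoods `Vs` of `(0, t₀)` and `Vu`
of `(z₀, 0)` with `cos (nθ + c) ≥ δ` does not start on the unstable manifold, and it starts
on the image of an orbit piece of length `m` only if `lam ^ m` is not much smaller than `r ^ (-n)`.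
Sufficient conditions: if `cos (nθ + c) ≤ -δ` there is an orbit piece of length `n` from the
unstable to the stable manifold, and if `cos (mθ + c) ≤ -δ` and `lam ^ m` is large compared with `r ^ (-n)`,
then there is one with two pieces of lengths `m` and `n`. -/
theorem IsPositiveTransition.exists_profile {S : ℂ × ℝ → ℂ × ℝ} {z₀ : ℂ} {t₀ : ℝ}
    {G : ℂ × ℝ →L[ℝ] ℝ} (hS : IsPositiveTransition S z₀ t₀ G) {μ : ℂ} {r θ lam : ℝ} (hr : 1 < r)
    (hμ : μ = r * Complex.exp (θ * Complex.I)) (hlam : 0 < lam) (hlam1 : lam < 1) :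
    ∃ c : ℝ, ∀ δ > 0, ∃ Vu ∈ 𝓝 (z₀, (0 : ℝ)), ∃ Vs ∈ 𝓝 ((0 : ℂ), t₀), ∃ C > 0,
      (∀ n : ℕ, δ ≤ Real.cos (n * θ + c) → ∀ w ∈ Vs, (focusMap μ lam)^[n] w ∈ Vu →
        (S w).2 ≠ 0 ∧ ∀ (m : ℕ), ∀ w' ∈ Vs, (focusMap μ lam)^[m] w' = S w →
          (r ^ n)⁻¹ ≤ C * lam ^ m) ∧
      ∀ Vu' ∈ 𝓝 (z₀, (0 : ℝ)), ∀ Vs' ∈ 𝓝 ((0 : ℂ), t₀), ∃ n₀ : ℕ,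
        (∀ n ≥ n₀, Real.cos (n * θ + c) ≤ -δ → ∃ y ∈ Vs', y.1 = 0 ∧ S y ∈ Vu' ∧ ∃ w ∈ Vs',
          (focusMap μ lam)^[n] w = S y ∧ S w ∈ Vu' ∧ (S w).2 = 0) ∧
        (∀ n ≥ n₀, ∀ m ≥ n₀, Real.cos (m * θ + c) ≤ -δ → C * (r ^ n)⁻¹ ≤ lam ^ m →
          ∃ y ∈ Vs', y.1 = 0 ∧ S y ∈ Vu' ∧ ∃ w ∈ Vs', (focusMap μ lam)^[n] w = S y ∧ S w ∈ Vu' ∧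
            ∃ w' ∈ Vs', (focusMap μ lam)^[m] w' = S w ∧ S w' ∈ Vu' ∧ (S w').2 = 0) := by
  have hr0 : 0 < r := by linarith
  have hμr : ‖μ‖ = r := by
    rw [hμ, norm_mul, Complex.norm_exp_ofReal_mul_I, mul_one, Complex.norm_real,
      Real.norm_of_nonneg hr0.le]
  have hμ0 : μ ≠ 0 := norm_pos_iff.mp (hμr ▸ hr0)
  have ht₀ := hS.pos
  obtain ⟨R, hR0, c, hR⟩ := hS.exists_phase hμ
  refine ⟨c, fun δ hδ => ?_⟩
  -- an error of half the size of the main term when the cosine is at least `δ`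
  set δ' : ℝ := R * δ / 2 with hδ'
  have hδ'0 : 0 < δ' := by positivity
  obtain ⟨ρ, hρ0, hρ1, V₁, hV₁, hest⟩ := hS.exists_height_estimate hr hμr hR hδ'0
  have hnonneg : ∀ᶠ p : ℂ × ℝ in 𝓝 (0, t₀), 0 ≤ (S (0, p.2)).2 := by
    have hsnd : Tendsto (fun p : ℂ × ℝ => p.2) (𝓝 (0, t₀)) (𝓝 t₀) :=
      continuous_snd.tendsto (_ : ℂ × ℝ)
    filter_upwards [hsnd.eventually hS.height_pos] with p hp
    rcases eq_or_ne p.2 t₀ with h | h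
    · rw [h, hS.map_eq]
    · exact (hp h).le
  have hsmall : ∀ᶠ p : ℂ × ℝ in 𝓝 (0, t₀), p.2 < 2 * t₀ :=
    continuous_snd.continuousAt.eventually_lt continuousAt_const (by simp; linarith)
  -- the first entry is for the necessary condition, the second one for the sufficient condition
  set C : ℝ := max (2 * t₀ / δ') ((R + δ') / t₀) with hC
  have hC0 : 0 < C := lt_max_of_lt_left (by positivity)
  refine ⟨Metric.ball z₀ ρ ×ˢ univ, prod_mem_nhds (Metric.ball_mem_nhds _ hρ0) univ_mem,
    V₁ ∩ {p | 0 ≤ (S (0, p.2)).2 ∧ p.2 < 2 * t₀}, inter_mem hV₁ (hnonneg.and hsmall),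
    C, hC0, ?_, ?_⟩
  · intro n hn w hw hwu
    have hrn : 0 < (r ^ n)⁻¹ := by positivity
    rw [focusMap_iterate] at hwu
    have hx : ‖μ ^ n * w.1 - z₀‖ < ρ := by simpa [dist_eq_norm] using hwu.1
    have hback : (μ ^ n)⁻¹ * (μ ^ n * w.1) = w.1 := inv_mul_cancel_left₀ (pow_ne_zero _ hμ0) _
    have h1 := hest n (μ ^ n * w.1) w.2 hx (by rw [hback]; exact hw.1)
    rw [hback] at h1
    have h2 : δ' * (r ^ n)⁻¹ ≤ (S w).2 := by
      have h3 := (abs_le.mp h1).1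
      have h4 : R * (r ^ n)⁻¹ * δ ≤ R * (r ^ n)⁻¹ * Real.cos (n * θ + c) :=
        mul_le_mul_of_nonneg_left hn (by positivity)
      have h5 : R * (r ^ n)⁻¹ * δ = 2 * (δ' * (r ^ n)⁻¹) := by rw [hδ']; ring
      have h6 : 0 ≤ (S (0, w.2)).2 := hw.2.1
      linarith
    refine ⟨(lt_of_lt_of_le (by positivity) h2).ne', fun m w' hw' heq => ?_⟩
    have h7 : (S w).2 ≤ lam ^ m * (2 * t₀) := by
      rw [← heq, focusMap_iterate]
      exact mul_le_mul_of_nonneg_left hw'.2.2.le (by positivity)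
    have h8 : (r ^ n)⁻¹ ≤ 2 * t₀ / δ' * lam ^ m := by
      rw [div_mul_eq_mul_div, le_div_iff₀ hδ'0]; linarith
    exact h8.trans (mul_le_mul_of_nonneg_right (le_max_left _ _) (by positivity))
  · intro Vu' hVu' Vs' hVs'
    have hScont : ContinuousAt S (0, t₀) := hS.continuousAt.self_of_nhds
    have hSu : ∀ᶠ p in 𝓝 ((0 : ℂ), t₀), S p ∈ Vu' := hScont.eventually_mem (hS.map_eq ▸ hVu')
    have hSz : ∀ᶠ p in 𝓝 ((0 : ℂ), t₀), ‖(S p).1 - z₀‖ < ρ := by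
      have : ContinuousAt (fun p => ‖(S p).1 - z₀‖) (0, t₀) :=
        (hScont.fst.sub continuousAt_const).norm
      exact this.eventually_lt continuousAt_const (by simp [hS.map_eq, hρ0])
    have hall := ((hSu.and hSz).and hS.continuousAt).and (inter_mem hV₁ hVs')
    obtain ⟨σ, hσ0, hσ⟩ := Metric.eventually_nhds_iff.mp hall
    obtain ⟨σ', hσ'0, hσ'⟩ := Metric.eventually_nhds_iff.mp hS.height_pos
    -- `η` bounds the heights both of the stable arc and of the orbit pieces
    set η : ℝ := min σ σ' / 2 with hη
    have hη0 : 0 < η := by positivity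
    have hησ : η < σ := by have := min_le_left σ σ'; linarith
    have hησ' : η < σ' := by have := min_le_right σ σ'; linarith
    have hbox : ∀ p : ℂ × ℝ, ‖p.1‖ < σ → p.2 ∈ Icc t₀ (t₀ + η) → dist p (0, t₀) < σ := by
      intro p hp1 hp2
      rw [Prod.dist_eq, max_lt_iff, dist_zero_right, Real.dist_eq, abs_lt]
      exact ⟨hp1, by linarith [hp2.1], by linarith [hp2.2]⟩
    set g₁ : ℝ := (S (0, t₀ + η)).2 with hg₁
    have hg₁0 : 0 < g₁ :=
      hσ' (y := t₀ + η) (by rw [Real.dist_eq]; simp [abs_of_pos hη0, hησ']) (by linarith)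
    have hrto : Tendsto (fun n : ℕ => (r ^ n)⁻¹) atTop (𝓝 0) :=
      tendsto_inv_atTop_zero.comp (tendsto_pow_atTop_atTop_of_one_lt hr)
    have hlto : Tendsto (fun n : ℕ => lam ^ n) atTop (𝓝 0) :=
      tendsto_pow_atTop_nhds_zero_of_lt_one hlam.le hlam1
    have hev1 : ∀ᶠ n : ℕ in atTop, (r ^ n)⁻¹ * (‖z₀‖ + 1) < σ := by
      have := hrto.mul_const (‖z₀‖ + 1)
      rw [zero_mul] at this
      exact this.eventually_lt_const hσ0
    have hev2 : ∀ᶠ n : ℕ in atTop, lam ^ n * (t₀ + η) < g₁ / 2 := by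
      have := hlto.mul_const (t₀ + η)
      rw [zero_mul] at this
      exact this.eventually_lt_const (by positivity)
    have hev3 : ∀ᶠ n : ℕ in atTop, (r ^ n)⁻¹ * (R + δ') < g₁ / 2 := by
      have := hrto.mul_const (R + δ')
      rw [zero_mul] at this
      exact this.eventually_lt_const (by positivity)
    obtain ⟨n₀, hn₀⟩ := eventually_atTop.mp (hev1.and (hev2.and hev3))
    -- pullbacks of points over the disc of radius `ρ` about `z₀`
    have hpull : ∀ n ≥ n₀, ∀ x : ℂ × ℝ, ‖x.1 - z₀‖ < ρ →
        dist (clampedPullback μ lam t₀ η n x) (0, t₀) < σ ∧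
        |(S (clampedPullback μ lam t₀ η n x)).2 - (S (0, (clampedPullback μ lam t₀ η n x).2)).2 -
          R * (r ^ n)⁻¹ * Real.cos (n * θ + c)| ≤ δ' * (r ^ n)⁻¹ := by
      intro n hn x hx
      have hd : dist (clampedPullback μ lam t₀ η n x) (0, t₀) < σ := by
        refine hbox _ ?_ (clampedPullback_snd_mem hη0.le)
        have hx' : ‖x.1‖ ≤ ‖z₀‖ + 1 := by
          have := norm_le_norm_add_norm_sub' x.1 z₀; linarith
        have : ‖(μ ^ n)⁻¹ * x.1‖ ≤ (r ^ n)⁻¹ * (‖z₀‖ + 1) := by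
          rw [norm_mul, norm_inv, norm_pow, hμr]; gcongr
        exact this.trans_lt (hn₀ n hn).1
      exact ⟨hd, hest n x.1 _ hx (hσ hd).2.1⟩
    have habs : ∀ n : ℕ, |R * (r ^ n)⁻¹ * Real.cos (n * θ + c)| ≤ R * (r ^ n)⁻¹ := by
      intro n
      have h0 : 0 ≤ R * (r ^ n)⁻¹ := by positivity
      rw [abs_mul, abs_of_nonneg h0]
      exact mul_le_of_le_one_right h0 (Real.abs_cos_le_one _)
    have hg₀ : (S (0, t₀)).2 = 0 := by rw [hS.map_eq]
    -- the equation changes sign between the two clamping heights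
    have hlow : ∀ n ≥ n₀, Real.cos (n * θ + c) ≤ -δ → ∀ x : ℂ × ℝ, ‖x.1 - z₀‖ < ρ →
        (clampedPullback μ lam t₀ η n x).2 = t₀ → (S (clampedPullback μ lam t₀ η n x)).2 < 0 := by
      intro n hn hcos x hx h
      have h1 := (abs_le.mp (hpull n hn x hx).2).2
      rw [h, hg₀] at h1
      have hrn : 0 < (r ^ n)⁻¹ := by positivity
      have h2 : R * (r ^ n)⁻¹ * Real.cos (n * θ + c) ≤ R * (r ^ n)⁻¹ * (-δ) :=
        mul_le_mul_of_nonneg_left hcos (by positivity)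
      have h3 : R * (r ^ n)⁻¹ * (-δ) = -2 * (δ' * (r ^ n)⁻¹) := by rw [hδ']; ring
      have h4 : 0 < δ' * (r ^ n)⁻¹ := by positivity
      linarith
    have hlow' : ∀ n ≥ n₀, ∀ x : ℂ × ℝ, ‖x.1 - z₀‖ < ρ →
        (clampedPullback μ lam t₀ η n x).2 = t₀ →
        (S (clampedPullback μ lam t₀ η n x)).2 ≤ (R + δ') * (r ^ n)⁻¹ := by
      intro n hn x hx h
      have h1 := (abs_le.mp (hpull n hn x hx).2).2
      rw [h, hg₀] at h1
      linarith [(abs_le.mp (habs n)).2]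
    have hhigh : ∀ n ≥ n₀, ∀ x : ℂ × ℝ, ‖x.1 - z₀‖ < ρ →
        (clampedPullback μ lam t₀ η n x).2 = t₀ + η →
        g₁ / 2 < (S (clampedPullback μ lam t₀ η n x)).2 := by
      intro n hn x hx h
      have h1 := (abs_le.mp (hpull n hn x hx).2).1
      rw [h, ← hg₁] at h1
      have := (hn₀ n hn).2.2
      linarith [(abs_le.mp (habs n)).1]
    have haxis : ∀ s ∈ Icc 0 η, dist ((0 : ℂ), t₀ + s) (0, t₀) < σ := fun s hs =>
      hbox _ (by simpa using hσ0) ⟨by linarith [hs.1], by linarith [hs.2]⟩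
    have hcurve : ContinuousOn (fun s : ℝ => S (0, t₀ + s)) (Icc 0 η) := fun s hs =>
      ((hσ (haxis s hs)).1.2.comp (f := fun s : ℝ => ((0 : ℂ), t₀ + s))
        (by fun_prop)).continuousWithinAt
    have hcz : ∀ s ∈ Icc 0 η, ‖(S (0, t₀ + s)).1 - z₀‖ < ρ := fun s hs => (hσ (haxis s hs)).1.1.2
    -- the hairpin: the pullback of the stable arc, from height `t₀` to height `t₀ + η`
    set P : ℕ → ℝ → ℂ × ℝ := fun n s => clampedPullback μ lam t₀ η n (S (0, t₀ + s)) with hP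
    have hPcont : ∀ n ≥ n₀, ContinuousOn (fun s => S (P n s)) (Icc 0 η) := fun n hn s hs =>
      (hσ (hpull n hn _ (hcz s hs)).1).1.2.comp_continuousWithinAt (f := P n)
        (continuous_clampedPullback.comp_continuousOn hcurve s hs)
    have hP0 : ∀ n, (P n 0).2 = t₀ := fun n => by
      refine clampedPullback_snd_of_le hlam ?_
      rw [add_zero, hg₀]; positivity
    have hP1 : ∀ n ≥ n₀, (P n η).2 = t₀ + η := fun n hn => by
      refine clampedPullback_snd_of_ge hlam hη0.le ?_
      rw [← hg₁]; linarith [(hn₀ n hn).2.1]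
    have h0mem : (0 : ℝ) ∈ Icc 0 η := ⟨le_rfl, hη0.le⟩
    have h1mem : η ∈ Icc 0 η := ⟨hη0.le, le_rfl⟩
    refine ⟨n₀, fun n hn hcos => ?_, fun n hn m hm hcos hnm => ?_⟩
    · have hz : (0 : ℝ) ∈ Icc (S (P n 0)).2 (S (P n η)).2 :=
        ⟨(hlow n hn hcos _ (hcz 0 h0mem) (hP0 n)).le,
          by linarith [hhigh n hn _ (hcz η h1mem) (hP1 n hn)]⟩
      obtain ⟨s, hs, hs0⟩ := intermediate_value_Icc hη0.le (hPcont n hn).snd hz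
      simp only at hs0
      have hs1 := hpull n hn _ (hcz s hs)
      refine ⟨(0, t₀ + s), (hσ (haxis s hs)).2.2, rfl, (hσ (haxis s hs)).1.1.1, P n s,
        (hσ hs1.1).2.2, iterate_clampedPullback hμ0 hlam hη0.le (fun h => ?_) (fun h => ?_),
        (hσ hs1.1).1.1.1, hs0⟩
      · exact (hlow n hn hcos _ (hcz s hs) h).ne hs0
      · have := hhigh n hn _ (hcz s hs) h
        linarith
    · set Q : ℝ → ℂ × ℝ := fun s => clampedPullback μ lam t₀ η m (S (P n s)) with hQ
      have hPz : ∀ s ∈ Icc 0 η, ‖(S (P n s)).1 - z₀‖ < ρ := fun s hs =>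
        (hσ (hpull n hn _ (hcz s hs)).1).1.1.2
      have hQcont : ContinuousOn (fun s => S (Q s)) (Icc 0 η) := fun s hs =>
        (hσ (hpull m hm _ (hPz s hs)).1).1.2.comp_continuousWithinAt (f := Q)
          (continuous_clampedPullback.comp_continuousOn (hPcont n hn) s hs)
      have hQlow : ∀ s ∈ Icc 0 η, (P n s).2 = t₀ → (Q s).2 = t₀ := by
        intro s hs h
        refine clampedPullback_snd_of_le hlam ((hlow' n hn _ (hcz s hs) h).trans ?_)
        have h1 : (R + δ') / t₀ * (r ^ n)⁻¹ ≤ lam ^ m :=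
          (mul_le_mul_of_nonneg_right (le_max_right _ _) (by positivity)).trans hnm
        rwa [div_mul_eq_mul_div, div_le_iff₀ ht₀] at h1
      have hQhigh : ∀ s ∈ Icc 0 η, (P n s).2 = t₀ + η → (Q s).2 = t₀ + η := by
        intro s hs h
        refine clampedPullback_snd_of_ge hlam hη0.le ?_
        linarith [hhigh n hn _ (hcz s hs) h, (hn₀ m hm).2.1]
      have hz : (0 : ℝ) ∈ Icc (S (Q 0)).2 (S (Q η)).2 :=
        ⟨(hlow m hm hcos _ (hPz 0 h0mem) (hQlow 0 h0mem (hP0 n))).le,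
          by linarith [hhigh m hm _ (hPz η h1mem) (hQhigh η h1mem (hP1 n hn))]⟩
      obtain ⟨s, hs, hs0⟩ := intermediate_value_Icc hη0.le hQcont.snd hz
      simp only at hs0
      have hs1 := hpull n hn _ (hcz s hs)
      have hs2 := hpull m hm _ (hPz s hs)
      have hQ1 : (Q s).2 ≠ t₀ := fun h => (hlow m hm hcos _ (hPz s hs) h).ne hs0
      have hQ2 : (Q s).2 ≠ t₀ + η := fun h => by
        have := hhigh m hm _ (hPz s hs) h
        linarith
      exact ⟨(0, t₀ + s), (hσ (haxis s hs)).2.2, rfl, (hσ (haxis s hs)).1.1.1, P n s,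
        (hσ hs1.1).2.2, iterate_clampedPullback hμ0 hlam hη0.le (fun h => hQ1 (hQlow s hs h))
          (fun h => hQ2 (hQhigh s hs h)), (hσ hs1.1).1.1.1, Q s, (hσ hs2.1).2.2,
        iterate_clampedPullback hμ0 hlam hη0.le hQ1 hQ2, (hσ hs2.1).1.1.1, hs0⟩

end SaddleFocus

/-! ### Homoclinic itineraries -/

namespace SaddleFocus

section Orbits

variable {X Y : Type*}

/-- The forward orbit of `x` under `F` stays in `B`. Near a hyperbolic fixed point this
characterizes the local stable manifold, or the unstable one for the inverse. -/
def StaysIn (F : X → X) (B : Set X) (x : X) : Prop := ∀ i, F^[i] x ∈ B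

/-- The orbit piece of length `n` from `w` to `x` lies in `B`. -/
def IsPassage (F : X → X) (B : Set X) (n : ℕ) (w x : X) : Prop :=
  F^[n] w = x ∧ ∀ i ≤ n, F^[i] w ∈ B

lemma StaysIn.map {h : X → Y} {B : Set X} {B' : Set Y} {F : X → X} {F' : Y → Y}
    (hF : Function.Semiconj h F F') (hB : MapsTo h B B')
    {x : X} (hx : StaysIn F B x) : StaysIn F' B' (h x) := fun i => by
  rw [← (hF.iterate_right i).eq]; exact hB (hx i)

lemma IsPassage.map {h : X → Y} {B : Set X} {B' : Set Y} {n : ℕ} {F : X → X} {F' : Y → Y}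
    (hF : Function.Semiconj h F F') (hB : MapsTo h B B')
    {w x : X} (hx : IsPassage F B n w x) : IsPassage F' B' n (h w) (h x) :=
  ⟨by rw [← (hF.iterate_right n).eq, hx.1], fun i hi => by
    rw [← (hF.iterate_right i).eq]; exact hB (hx.2 i hi)⟩

end Orbits

section Returns

variable {X Y : Type*} [TopologicalSpace X] [TopologicalSpace Y]

lemma iterate_apply_symm (f : X ≃ₜ X) (n : ℕ) (x : X) : f^[n] (f.symm^[n] x) = x :=
  Function.RightInverse.iterate f.right_inv n x

lemma iterate_symm_apply (f : X ≃ₜ X) (n : ℕ) (x : X) : f.symm^[n] (f^[n] x) = x :=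
  Function.LeftInverse.iterate f.left_inv n x

/-- There is a homoclinic orbit that leaves `B` through `Vu`, arrives after `K` steps in `Vs`,
passes through `B` to `Vu` in `n` steps, and after `K` further steps is in `Vs` again and stays
in `B`. -/
def SingleReturn (f : X ≃ₜ X) (K : ℕ) (Vu Vs B : Set X) (n : ℕ) : Prop :=
  ∃ y ∈ Vs, StaysIn f B y ∧ f.symm^[K] y ∈ Vu ∧
    ∃ w ∈ Vs, IsPassage f B n w (f.symm^[K] y) ∧ f.symm^[K] w ∈ Vu ∧
      StaysIn f.symm B (f.symm^[K] w)

/-- There is a homoclinic orbit as for `SingleReturn`, but with two passages through `B`, the first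
of length `m` and the second of length `n`. -/
def DoubleReturn (f : X ≃ₜ X) (K : ℕ) (Vu Vs B : Set X) (n m : ℕ) : Prop :=
  ∃ y ∈ Vs, StaysIn f B y ∧ f.symm^[K] y ∈ Vu ∧
    ∃ w ∈ Vs, IsPassage f B n w (f.symm^[K] y) ∧ f.symm^[K] w ∈ Vu ∧
      ∃ w' ∈ Vs, IsPassage f B m w' (f.symm^[K] w) ∧ f.symm^[K] w' ∈ Vu ∧
        StaysIn f.symm B (f.symm^[K] w')

variable {f : X ≃ₜ X} {g : Y ≃ₜ Y} {h : X → Y} {K n m : ℕ} {Vu Vs B : Set X} {Vu' Vs' B' : Set Y}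

lemma semiconj_symm (hfg : Function.Semiconj h f g) : Function.Semiconj h f.symm g.symm := by
  intro x
  rw [Homeomorph.eq_symm_apply, ← hfg.eq, f.apply_symm_apply]

lemma SingleReturn.map (hfg : Function.Semiconj h f g) (hu : MapsTo h Vu Vu')
    (hs : MapsTo h Vs Vs') (hB : MapsTo h B B') (H : SingleReturn f K Vu Vs B n) :
    SingleReturn g K Vu' Vs' B' n := by
  have hfg' := semiconj_symm hfg
  have hK := (hfg'.iterate_right K).eq
  obtain ⟨y, hy, hy1, hy2, w, hw, hw1, hw2, hw3⟩ := H
  exact ⟨h y, hs hy, hy1.map hfg hB, hK y ▸ hu hy2, h w, hs hw, hK y ▸ hw1.map hfg hB,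
    hK w ▸ hu hw2, hK w ▸ hw3.map hfg' hB⟩

lemma DoubleReturn.map (hfg : Function.Semiconj h f g) (hu : MapsTo h Vu Vu')
    (hs : MapsTo h Vs Vs') (hB : MapsTo h B B') (H : DoubleReturn f K Vu Vs B n m) :
    DoubleReturn g K Vu' Vs' B' n m := by
  have hfg' := semiconj_symm hfg
  have hK := (hfg'.iterate_right K).eq
  obtain ⟨y, hy, hy1, hy2, w, hw, hw1, hw2, w', hw', hw1', hw2', hw3⟩ := H
  exact ⟨h y, hs hy, hy1.map hfg hB, hK y ▸ hu hy2, h w, hs hw, hK y ▸ hw1.map hfg hB,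
    hK w ▸ hu hw2, h w', hs hw', hK w ▸ hw1'.map hfg hB, hK w' ▸ hu hw2', hK w' ▸ hw3.map hfg' hB⟩

end Returns

/-- In the chart `Φ` centred at `p` the homeomorphism `f` is, on the bounded open set `U`, the
linear model of a saddle-focus. -/
structure IsFocusChart {M : Type*} [TopologicalSpace M] (f : M ≃ₜ M) (p : M)
    (Φ : OpenPartialHomeomorph M (ℂ × ℝ)) (U : Set (ℂ × ℝ)) (μ : ℂ) (lam : ℝ) : Prop where
  mem_source : p ∈ Φ.source
  map_self : Φ p = 0
  isOpen : IsOpen U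
  isBounded : Bornology.IsBounded U
  zero_mem : 0 ∈ U
  subset_target : U ⊆ Φ.target
  linear : ∀ v ∈ U, f (Φ.symm v) ∈ Φ.source ∧ Φ (f (Φ.symm v)) = focusMap μ lam v
  one_lt : 1 < ‖μ‖
  lam_pos : 0 < lam
  lam_lt : lam < 1

namespace IsFocusChart

variable {M : Type*} [TopologicalSpace M] {f : M ≃ₜ M} {p : M}
  {Φ : OpenPartialHomeomorph M (ℂ × ℝ)} {U : Set (ℂ × ℝ)} {μ : ℂ} {lam : ℝ}

/-- The part of the manifold on which `f` is linear. -/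
lemma image_eq (hΦ : IsFocusChart f p Φ U μ lam) : Φ.symm '' U = Φ.source ∩ Φ ⁻¹' U :=
  Φ.symm_image_eq_source_inter_preimage hΦ.subset_target

lemma image_mem_nhds (hΦ : IsFocusChart f p Φ U μ lam) : Φ.symm '' U ∈ 𝓝 p := by
  refine (Φ.isOpen_image_symm_of_subset_target hΦ.isOpen hΦ.subset_target).mem_nhds ?_
  rw [hΦ.image_eq]
  exact ⟨hΦ.mem_source, by rw [mem_preimage, hΦ.map_self]; exact hΦ.zero_mem⟩

lemma apply_iterate (hΦ : IsFocusChart f p Φ U μ lam) {x : M} {n : ℕ}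
    (hx : ∀ i < n, f^[i] x ∈ Φ.symm '' U) : Φ (f^[n] x) = (focusMap μ lam)^[n] (Φ x) := by
  induction n with
  | zero => rfl
  | succ n ih =>
    have hn := hx n (by omega)
    rw [hΦ.image_eq] at hn
    rw [Function.iterate_succ_apply', Function.iterate_succ_apply',
      ← ih (fun i hi => hx i (by omega))]
    have := (hΦ.linear _ hn.2).2
    rwa [Φ.left_inv hn.1] at this

lemma fst_eq_zero (hΦ : IsFocusChart f p Φ U μ lam) {x : M}
    (hx : StaysIn f (Φ.symm '' U) x) : (Φ x).1 = 0 := by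
  obtain ⟨C, hC⟩ := hΦ.isBounded.exists_norm_le
  by_contra hne
  have h1 : ∀ n : ℕ, ‖μ‖ ^ n * ‖(Φ x).1‖ ≤ C := fun n => by
    have h2 := hx n
    rw [hΦ.image_eq] at h2
    have h3 := hC _ h2.2
    rw [hΦ.apply_iterate (fun i _ => hx i), focusMap_iterate] at h3
    have h4 := (norm_fst_le _).trans h3
    rwa [norm_mul, norm_pow] at h4
  have h5 := (tendsto_pow_atTop_atTop_of_one_lt hΦ.one_lt).atTop_mul_const (norm_pos_iff.mpr hne)
  obtain ⟨n, hn⟩ := (h5.eventually_gt_atTop C).exists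
  linarith [h1 n]

lemma snd_eq_zero (hΦ : IsFocusChart f p Φ U μ lam) {x : M}
    (hx : StaysIn f.symm (Φ.symm '' U) x) : (Φ x).2 = 0 := by
  obtain ⟨C, hC⟩ := hΦ.isBounded.exists_norm_le
  have h1 : ∀ n : ℕ, ‖(Φ x).2‖ ≤ lam ^ n * C := fun n => by
    have hn : f^[n] (f.symm^[n] x) = x := iterate_apply_symm f n x
    have h2 : Φ x = (focusMap μ lam)^[n] (Φ (f.symm^[n] x)) := by
      rw [← hΦ.apply_iterate, hn]
      intro i hi
      have : f^[i] (f.symm^[n] x) = f.symm^[n - i] x := by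
        obtain ⟨j, rfl⟩ := Nat.exists_eq_add_of_lt hi
        rw [show i + j + 1 = i + (j + 1) by ring, Function.iterate_add_apply,
          iterate_apply_symm, Nat.add_sub_cancel_left]
      rw [this]; exact hx _
    have h3 := hx n
    rw [hΦ.image_eq] at h3
    have h4 := (norm_snd_le _).trans (hC _ h3.2)
    rw [h2, focusMap_iterate, norm_mul, norm_pow, Real.norm_of_nonneg hΦ.lam_pos.le]
    exact mul_le_mul_of_nonneg_left h4 (pow_nonneg hΦ.lam_pos.le n)
  have h5 := (tendsto_pow_atTop_nhds_zero_of_lt_one hΦ.lam_pos.le hΦ.lam_lt).mul_const C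
  rw [zero_mul] at h5
  exact norm_le_zero_iff.mp (ge_of_tendsto' h5 h1)

lemma iterate_symm (hΦ : IsFocusChart f p Φ U μ lam) {v : ℂ × ℝ} {n : ℕ}
    (hU : ∀ i < n, (focusMap μ lam)^[i] v ∈ U) :
    f^[n] (Φ.symm v) = Φ.symm ((focusMap μ lam)^[n] v) := by
  induction n with
  | zero => rfl
  | succ n ih =>
    have hn := hΦ.linear _ (hU n (by omega))
    rw [Function.iterate_succ_apply', Function.iterate_succ_apply',
      ih (fun i hi => hU i (by omega)), ← hn.2, Φ.left_inv hn.1]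

/-- A box contains with the endpoints all intermediate points of an orbit piece of the model. -/
lemma iterate_mem_ball (hΦ : IsFocusChart f p Φ U μ lam) {v : ℂ × ℝ} {ε : ℝ} {n i : ℕ}
    (hi : i ≤ n) (hv : v ∈ Metric.ball 0 ε) (hn : (focusMap μ lam)^[n] v ∈ Metric.ball 0 ε) :
    (focusMap μ lam)^[i] v ∈ Metric.ball 0 ε := by
  rw [mem_ball_zero_iff, focusMap_iterate, Prod.norm_def, max_lt_iff] at hn ⊢
  rw [mem_ball_zero_iff, Prod.norm_def, max_lt_iff] at hv
  simp only [norm_mul, norm_pow] at *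
  refine ⟨lt_of_le_of_lt ?_ hn.1, lt_of_le_of_lt ?_ hv.2⟩
  · exact mul_le_mul_of_nonneg_right (pow_le_pow_right₀ hΦ.one_lt.le hi) (norm_nonneg _)
  · rw [Real.norm_of_nonneg hΦ.lam_pos.le]
    exact mul_le_of_le_one_left (norm_nonneg _) (pow_le_one₀ hΦ.lam_pos.le hΦ.lam_lt.le)

lemma isPassage_symm (hΦ : IsFocusChart f p Φ U μ lam) {W : Set M} {v : ℂ × ℝ} {ε : ℝ} {n : ℕ}
    (hεU : Metric.ball 0 ε ⊆ U) (hεW : ∀ v ∈ Metric.ball 0 ε, Φ.symm v ∈ W)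
    (hv : v ∈ Metric.ball 0 ε) (hn : (focusMap μ lam)^[n] v ∈ Metric.ball 0 ε) :
    IsPassage f W n (Φ.symm v) (Φ.symm ((focusMap μ lam)^[n] v)) := by
  have key : ∀ i ≤ n, f^[i] (Φ.symm v) = Φ.symm ((focusMap μ lam)^[i] v) := fun i hi =>
    hΦ.iterate_symm fun j hj =>
      hεU (hΦ.iterate_mem_ball (by omega) hv hn)
  exact ⟨key n le_rfl, fun i hi => by
    rw [key i hi]; exact hεW _ (hΦ.iterate_mem_ball hi hv hn)⟩

lemma staysIn_symm (hΦ : IsFocusChart f p Φ U μ lam) {W : Set M} {v : ℂ × ℝ} {ε : ℝ}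
    (hεU : Metric.ball 0 ε ⊆ U) (hεW : ∀ v ∈ Metric.ball 0 ε, Φ.symm v ∈ W)
    (hv : v ∈ Metric.ball 0 ε) (h0 : v.1 = 0) : StaysIn f W (Φ.symm v) := by
  intro i
  refine (hΦ.isPassage_symm (n := i) hεU hεW hv ?_).2 i le_rfl
  rw [mem_ball_zero_iff, Prod.norm_def, max_lt_iff] at *
  rw [focusMap_iterate, h0, mul_zero, norm_mul, norm_pow, Real.norm_of_nonneg hΦ.lam_pos.le]
  refine ⟨by simpa [h0] using hv.1, lt_of_le_of_lt ?_ hv.2⟩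
  exact mul_le_of_le_one_left (norm_nonneg _) (pow_le_one₀ hΦ.lam_pos.le hΦ.lam_lt.le)

lemma staysIn_symm_symm (hΦ : IsFocusChart f p Φ U μ lam) {W : Set M} {v : ℂ × ℝ} {ε : ℝ}
    (hεU : Metric.ball 0 ε ⊆ U) (hεW : ∀ v ∈ Metric.ball 0 ε, Φ.symm v ∈ W)
    (hv : v ∈ Metric.ball 0 ε) (h0 : v.2 = 0) : StaysIn f.symm W (Φ.symm v) := by
  intro i
  have hμ0 : μ ≠ 0 := norm_pos_iff.mp (by linarith [hΦ.one_lt])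
  set w : ℂ × ℝ := ((μ ^ i)⁻¹ * v.1, 0) with hw
  have hwv : (focusMap μ lam)^[i] w = v := by
    rw [focusMap_iterate]
    ext1
    · exact mul_inv_cancel_left₀ (pow_ne_zero _ hμ0) _
    · simp [hw, h0]
  have hwball : w ∈ Metric.ball 0 ε := by
    rw [mem_ball_zero_iff, Prod.norm_def, max_lt_iff] at *
    refine ⟨lt_of_le_of_lt ?_ hv.1, by simpa [hw, h0] using hv.2⟩
    rw [hw, norm_mul, norm_inv, norm_pow]
    exact mul_le_of_le_one_left (norm_nonneg _) (inv_le_one_of_one_le₀ (one_le_pow₀ hΦ.one_lt.le))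
  have h1 := hΦ.isPassage_symm (n := i) hεU hεW hwball (by rwa [hwv])
  rw [hwv] at h1
  rw [← h1.1, iterate_symm_apply]
  exact hεW w hwball

/-- The itineraries of homoclinic orbits near a saddle-focus: `exists_profile` for the transition
`f ^ (-K)` read in the chart. The necessary conditions hold for orbits in the whole linear domain,
the sufficient ones produce orbits in a prescribed neighbourhood `W` of `p`, provided that the box
spanned by the two points of the homoclinic orbit is contained in it. -/
theorem exists_return_profile (hΦ : IsFocusChart f p Φ U μ lam) {W : Set M} {ε r θ : ℝ}
    {z₀ : ℂ} {t₀ : ℝ} {G : ℂ × ℝ →L[ℝ] ℝ} {K : ℕ} {qs : M}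
    (hμ : μ = r * Complex.exp (θ * Complex.I)) (hr : 1 < r)
    (hεU : Metric.ball 0 ε ⊆ U) (hεW : ∀ v ∈ Metric.ball 0 ε, Φ.symm v ∈ W)
    (hqs : qs ∈ Φ.source) (hqu : f.symm^[K] qs ∈ Φ.source) (hqs0 : Φ qs = (0, t₀))
    (hqsε : Φ qs ∈ Metric.ball 0 ε) (hquε : Φ (f.symm^[K] qs) ∈ Metric.ball 0 ε)
    (hS : IsPositiveTransition (fun v => Φ (f.symm^[K] (Φ.symm v))) z₀ t₀ G) :
    ∃ c : ℝ, ∀ δ > 0, ∃ Vu ∈ 𝓝 (f.symm^[K] qs), ∃ Vs ∈ 𝓝 qs, ∃ C > 0,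
      (∀ n : ℕ, δ ≤ Real.cos (n * θ + c) → ¬ SingleReturn f K Vu Vs (Φ.symm '' U) n) ∧
      (∀ n m : ℕ, δ ≤ Real.cos (n * θ + c) → DoubleReturn f K Vu Vs (Φ.symm '' U) n m →
        (r ^ n)⁻¹ ≤ C * lam ^ m) ∧
      ∀ Vu' ∈ 𝓝 (f.symm^[K] qs), ∀ Vs' ∈ 𝓝 qs, ∃ n₀ : ℕ,
        (∀ n ≥ n₀, Real.cos (n * θ + c) ≤ -δ → SingleReturn f K Vu' Vs' W n) ∧
        (∀ n ≥ n₀, ∀ m ≥ n₀, Real.cos (m * θ + c) ≤ -δ → C * (r ^ n)⁻¹ ≤ lam ^ m →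
          DoubleReturn f K Vu' Vs' W n m) := by
  set S : ℂ × ℝ → ℂ × ℝ := fun v => Φ (f.symm^[K] (Φ.symm v)) with hSdef
  have hsymm : Φ.symm (0, t₀) = qs := by rw [← hqs0, Φ.left_inv hqs]
  have hqu0 : Φ (f.symm^[K] qs) = (z₀, 0) := by
    rw [← hS.map_eq, ← hsymm]
  have hsymm' : Φ.symm (z₀, 0) = f.symm^[K] qs := by rw [← hqu0, Φ.left_inv hqu]
  have hts : ((0 : ℂ), t₀) ∈ Φ.target := hqs0 ▸ Φ.map_source hqs
  have htu : (z₀, (0 : ℝ)) ∈ Φ.target := hqu0 ▸ Φ.map_source hqu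
  have hfK : Continuous (f.symm^[K]) := f.symm.continuous.iterate K
  obtain ⟨c, hc⟩ := hS.exists_profile hr hμ hΦ.lam_pos hΦ.lam_lt
  refine ⟨c, fun δ hδ => ?_⟩
  obtain ⟨Vu, hVu, Vs, hVs, C, hC, hnec, hsuf⟩ := hc δ hδ
  have hpass : ∀ {n : ℕ} {w x : M}, w ∈ Φ.source → IsPassage f (Φ.symm '' U) n w x →
      (focusMap μ lam)^[n] (Φ w) = Φ x := by
    intro n w x hw hwx
    rw [← hwx.1, hΦ.apply_iterate (fun i hi => hwx.2 i hi.le)]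
  have hSΦ : ∀ {w : M}, w ∈ Φ.source → S (Φ w) = Φ (f.symm^[K] w) := by
    intro w hw; simp only [hSdef]; rw [Φ.left_inv hw]
  refine ⟨Φ.source ∩ Φ ⁻¹' Vu, inter_mem (Φ.open_source.mem_nhds hqu)
      ((Φ.continuousAt hqu).preimage_mem_nhds (hqu0 ▸ hVu)),
    Φ.source ∩ Φ ⁻¹' Vs, inter_mem (Φ.open_source.mem_nhds hqs)
      ((Φ.continuousAt hqs).preimage_mem_nhds (hqs0 ▸ hVs)), C, hC, ?_, ?_, ?_⟩
  · rintro n hn ⟨y, hy, -, hy2, w, hw, hw1, -, hw3⟩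
    have h1 := hpass hw.1 hw1
    refine (hnec n hn (Φ w) hw.2 (by rw [h1]; exact hy2.2)).1 ?_
    rw [hSΦ hw.1]; exact hΦ.snd_eq_zero hw3
  · rintro n m hn ⟨y, hy, -, hy2, w, hw, hw1, hw2, w', hw', hw1', -, -⟩
    have h1 := hpass hw.1 hw1
    refine (hnec n hn (Φ w) hw.2 (by rw [h1]; exact hy2.2)).2 m (Φ w') hw'.2 ?_
    rw [hSΦ hw.1, hpass hw'.1 hw1']
  · intro Vu' hVu' Vs' hVs'
    -- neighbourhoods in the model on which the chart can be inverted
    obtain ⟨n₀, hn1, hn2⟩ := hsuf (Φ.symm ⁻¹' Vu' ∩ Metric.ball 0 ε)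
      (inter_mem ((Φ.continuousAt_symm htu).preimage_mem_nhds (hsymm' ▸ hVu'))
        (Metric.isOpen_ball.mem_nhds (hqu0 ▸ hquε)))
      ((Φ.symm ⁻¹' Vs' ∩ Metric.ball 0 ε) ∩ (fun v => f.symm^[K] (Φ.symm v)) ⁻¹' Φ.source)
      (inter_mem (inter_mem ((Φ.continuousAt_symm hts).preimage_mem_nhds (hsymm ▸ hVs'))
        (Metric.isOpen_ball.mem_nhds (hqs0 ▸ hqsε)))
        ((hfK.continuousAt.comp (Φ.continuousAt_symm hts)).preimage_mem_nhds
          (Φ.open_source.mem_nhds (by simp only [Function.comp_apply]; rwa [hsymm]))))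
    have hback : ∀ {v : ℂ × ℝ}, f.symm^[K] (Φ.symm v) ∈ Φ.source →
        Φ.symm (S v) = f.symm^[K] (Φ.symm v) := fun hv => Φ.left_inv hv
    refine ⟨n₀, fun n hn hcos => ?_, fun n hn m hm hcos hnm => ?_⟩
    · obtain ⟨y, hy, hy0, hyu, w, hw, hwy, hwu, hw0⟩ := hn1 n hn hcos
      refine ⟨Φ.symm y, hy.1.1, hΦ.staysIn_symm hεU hεW hy.1.2 hy0, hback hy.2 ▸ hyu.1,
        Φ.symm w, hw.1.1, ?_, hback hw.2 ▸ hwu.1, ?_⟩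
      · rw [← hback hy.2, ← hwy]
        exact hΦ.isPassage_symm hεU hεW hw.1.2 (hwy ▸ hyu.2)
      · rw [← hback hw.2]; exact hΦ.staysIn_symm_symm hεU hεW hwu.2 hw0
    · obtain ⟨y, hy, hy0, hyu, w, hw, hwy, hwu, w', hw', hwy', hwu', hw0⟩ := hn2 n hn m hm hcos hnm
      refine ⟨Φ.symm y, hy.1.1, hΦ.staysIn_symm hεU hεW hy.1.2 hy0, hback hy.2 ▸ hyu.1,
        Φ.symm w, hw.1.1, ?_, hback hw.2 ▸ hwu.1, Φ.symm w', hw'.1.1, ?_, hback hw'.2 ▸ hwu'.1, ?_⟩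
      · rw [← hback hy.2, ← hwy]
        exact hΦ.isPassage_symm hεU hεW hw.1.2 (hwy ▸ hyu.2)
      · rw [← hback hw.2, ← hwy']
        exact hΦ.isPassage_symm hεU hεW hw'.1.2 (hwy' ▸ hwu.2)
      · rw [← hback hw'.2]; exact hΦ.staysIn_symm_symm hεU hεW hwu'.2 hw0

end IsFocusChart

end SaddleFocus

/-! ### The chart of a diffeomorphism with a homoclinic tangency -/

namespace SaddleFocus

namespace IsFocusChart

variable {M : Type*} [TopologicalSpace M] {f : M ≃ₜ M} {p q : M}
  {Φ : OpenPartialHomeomorph M (ℂ × ℝ)} {U : Set (ℂ × ℝ)} {μ : ℂ} {lam : ℝ}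

lemma mem_source_of_mem (hΦ : IsFocusChart f p Φ U μ lam) {x : M} (hx : x ∈ Φ.symm '' U) :
    x ∈ Φ.source := by
  rw [hΦ.image_eq] at hx; exact hx.1

lemma map_fixed (hΦ : IsFocusChart f p Φ U μ lam) : f p = p := by
  have h := hΦ.linear 0 hΦ.zero_mem
  have hp : Φ.symm 0 = p := by rw [← hΦ.map_self, Φ.left_inv hΦ.mem_source]
  rw [hp] at h
  refine Φ.injOn h.1 hΦ.mem_source ?_
  rw [h.2, hΦ.map_self]
  simp [focusMap]

/-- The forward orbit of a point of the stable manifold in the chart. -/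
lemma exists_stable_orbit (hΦ : IsFocusChart f p Φ U μ lam) (hq : q ∈ stableSet f p)
    (hne : q ≠ p) : ∃ (N : ℕ) (t : ℝ), t ≠ 0 ∧ ∀ n : ℕ, f^[N + n] q ∈ Φ.symm '' U ∧
      Φ (f^[N + n] q) = (0, lam ^ n * t) := by
  obtain ⟨N, hN⟩ := eventually_atTop.mp (hq.eventually hΦ.image_mem_nhds)
  have hstay : StaysIn f (Φ.symm '' U) (f^[N] q) := fun i => by
    rw [← Function.iterate_add_apply]; exact hN _ (by omega)
  have h1 : Φ (f^[N] q) = (0, (Φ (f^[N] q)).2) := Prod.ext (hΦ.fst_eq_zero hstay) rfl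
  refine ⟨N, (Φ (f^[N] q)).2, fun h0 => hne ?_, fun n => ⟨hN _ (by omega), ?_⟩⟩
  · have hsrc : f^[N] q ∈ Φ.source := hΦ.mem_source_of_mem (hN N le_rfl)
    have h2 : f^[N] q = p := Φ.injOn hsrc hΦ.mem_source (by
      rw [h1, h0, hΦ.map_self]; rfl)
    have h3 : f^[N] p = p := Function.iterate_fixed hΦ.map_fixed N
    exact f.injective.iterate N (h2.trans h3.symm)
  · rw [add_comm, Function.iterate_add_apply, hΦ.apply_iterate (fun i _ => hstay i),
      focusMap_iterate, h1]
    simp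

/-- The backward orbit of a point of the unstable manifold in the chart. -/
lemma exists_unstable_orbit (hΦ : IsFocusChart f p Φ U μ lam) (hq : q ∈ stableSet f.symm p)
    (hne : q ≠ p) : ∃ N : ℕ, ∀ n ≥ N, f.symm^[n] q ∈ Φ.symm '' U ∧
      (Φ (f.symm^[n] q)).1 ≠ 0 ∧ (Φ (f.symm^[n] q)).2 = 0 := by
  obtain ⟨N, hN⟩ := eventually_atTop.mp (hq.eventually hΦ.image_mem_nhds)
  refine ⟨N, fun n hn => ?_⟩
  have hstay : StaysIn f.symm (Φ.symm '' U) (f.symm^[n] q) := fun i => by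
    rw [← Function.iterate_add_apply]; exact hN _ (by omega)
  refine ⟨hN n hn, fun h0 => hne ?_, hΦ.snd_eq_zero hstay⟩
  have hsrc : f.symm^[n] q ∈ Φ.source := hΦ.mem_source_of_mem (hN n hn)
  have h2 : f.symm^[n] q = p := Φ.injOn hsrc hΦ.mem_source (by
    rw [hΦ.map_self]; exact Prod.ext h0 (hΦ.snd_eq_zero hstay))
  have h3 : f.symm^[n] p = p :=
    Function.iterate_fixed (by rw [Homeomorph.symm_apply_eq, hΦ.map_fixed]) n
  exact f.symm.injective.iterate n (h2.trans h3.symm)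

end IsFocusChart

/-- If `S` is a left inverse of `T` near `v`, the second component of `S` is regular at `T v`. -/
lemma snd_fderiv_ne_zero {S T : ℂ × ℝ → ℂ × ℝ} {v : ℂ × ℝ} (hT : DifferentiableAt ℝ T v)
    (hS : DifferentiableAt ℝ S (T v)) (hST : ∀ᶠ x in 𝓝 v, S (T x) = x) :
    (ContinuousLinearMap.snd ℝ ℂ ℝ).comp (fderiv ℝ S (T v)) ≠ 0 := by
  intro h0
  have h1 : HasFDerivAt (fun x => S (T x)) ((fderiv ℝ S (T v)).comp (fderiv ℝ T v)) v :=
    hS.hasFDerivAt.comp v hT.hasFDerivAt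
  have h2 : HasFDerivAt (fun x => S (T x)) (ContinuousLinearMap.id ℝ (ℂ × ℝ)) v :=
    (hasFDerivAt_id v).congr_of_eventuallyEq hST
  have h3 := h1.unique h2
  have h4 := congrArg (fun A : ℂ × ℝ →L[ℝ] ℂ × ℝ => (A (0, 1)).2) h3
  have h5 := congrArg (fun A : ℂ × ℝ →L[ℝ] ℝ => A (fderiv ℝ T v (0, 1))) h0
  simp at h4 h5
  rw [h5] at h4
  exact zero_ne_one h4

section LinearChart

variable {M : Type*} [TopologicalSpace M] {φ : OpenPartialHomeomorph M E3} {ε : ℝ}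
  {L : E3 ≃L[ℝ] ℂ × ℝ}

/-- The chart `φ` followed by the linear coordinate change `L`. -/
noncomputable def linearChart (φ : OpenPartialHomeomorph M E3) (L : E3 ≃L[ℝ] ℂ × ℝ) :
    OpenPartialHomeomorph M (ℂ × ℝ) :=
  φ.transHomeomorph L.toHomeomorph

lemma linearChart_apply (x : M) : linearChart φ L x = L (φ x) := rfl

lemma linearChart_symm_apply (v : ℂ × ℝ) : (linearChart φ L).symm v = φ.symm (L.symm v) := rfl

lemma linearChart_symm_image : (linearChart φ L).symm '' (L '' Metric.ball 0 ε) = nbhd φ ε := by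
  rw [nbhd, image_image]
  simp only [linearChart_symm_apply, ContinuousLinearEquiv.symm_apply_apply]

end LinearChart

section Chart

variable {M : Type*} [TopologicalSpace M] [ChartedSpace E3 M] {k : WithTop ℕ∞}
  {f : M ≃ₘ^k⟮𝓡 3, 𝓡 3⟯ M} {p q : M} {φ : OpenPartialHomeomorph M E3} {ε : ℝ}
  {A : E3 ≃L[ℝ] E3} {L : E3 ≃L[ℝ] ℂ × ℝ} {μ : ℂ} {lam : ℝ}

lemma isFocusChart_linearChart (hf : IsLinearNear f p φ ε A)
    (hL : ∀ v, L (A v) = focusMap μ lam (L v)) (hμ : 1 < ‖μ‖) (h0 : 0 < lam) (h1 : lam < 1) :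
    IsFocusChart f.toHomeomorph p (linearChart φ L) (L '' Metric.ball 0 ε) μ lam where
  mem_source := hf.mem_source
  map_self := by rw [linearChart_apply, hf.map_self, map_zero]
  isOpen := L.toHomeomorph.isOpenMap _ Metric.isOpen_ball
  isBounded := L.lipschitz.isBounded_image Metric.isBounded_ball
  zero_mem := ⟨0, Metric.mem_ball_self hf.radius_pos, map_zero L⟩
  subset_target := by
    rintro _ ⟨v, hv, rfl⟩
    change L.symm (L v) ∈ φ.target
    rw [L.symm_apply_apply]; exact hf.ball_subset hv
  linear := by
    rintro _ ⟨v, hv, rfl⟩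
    rw [linearChart_symm_apply, L.symm_apply_apply, linearChart_apply, ← hL]
    exact ⟨(hf.linear v hv).1, congrArg L (hf.linear v hv).2⟩
  one_lt := hμ
  lam_pos := h0
  lam_lt := h1

lemma mem_stableSet_of_fst_eq_zero (hL : ∀ v, L (A v) = focusMap μ lam (L v)) (h0 : 0 < lam)
    (h1 : lam < 1) {v : E3} (hv : (L v).1 = 0) : v ∈ stableSet A 0 := by
  have h2 : ∀ n : ℕ, A^[n] v = L.symm (0, lam ^ n * (L v).2) := fun n => by
    have h3 : L (A^[n] v) = (focusMap μ lam)^[n] (L v) :=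
      (Function.Semiconj.iterate_right hL n).eq v
    rw [L.eq_symm_apply, h3, focusMap_iterate, hv, mul_zero]
  change Tendsto (fun n : ℕ => A^[n] v) atTop (𝓝 0)
  simp only [h2]
  have h4 : Tendsto (fun n : ℕ => ((0 : ℂ), lam ^ n * (L v).2)) atTop (𝓝 (0, 0)) := by
    refine tendsto_const_nhds.prodMk_nhds ?_
    have := (tendsto_pow_atTop_nhds_zero_of_lt_one h0.le h1).mul_const (L v).2
    rwa [zero_mul] at this
  have h5 := (L.symm.continuous.tendsto (0, 0)).comp h4
  rwa [Prod.mk_zero_zero, map_zero] at h5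

lemma mem_stableSet_symm_of_snd_eq_zero (hL : ∀ v, L (A v) = focusMap μ lam (L v)) (hμ : 1 < ‖μ‖)
    {v : E3} (hv : (L v).2 = 0) : v ∈ stableSet A.symm 0 := by
  have hμ0 : μ ≠ 0 := norm_pos_iff.mp (by linarith)
  have h2 : ∀ n : ℕ, A.symm^[n] v = L.symm ((μ⁻¹) ^ n * (L v).1, 0) := fun n => by
    induction n with
    | zero => simp [← hv]
    | succ n ih =>
      rw [Function.iterate_succ_apply', ih, A.symm_apply_eq, ← L.injective.eq_iff, hL,
        L.apply_symm_apply, L.apply_symm_apply]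
      ext1
      · simp only [focusMap, pow_succ']
        rw [mul_assoc, mul_inv_cancel_left₀ hμ0]
      · simp [focusMap]
  change Tendsto (fun n : ℕ => A.symm^[n] v) atTop (𝓝 0)
  simp only [h2]
  have h4 : Tendsto (fun n : ℕ => ((μ⁻¹) ^ n * (L v).1, (0 : ℝ))) atTop (𝓝 (0, 0)) := by
    refine Tendsto.prodMk_nhds ?_ tendsto_const_nhds
    have := (tendsto_pow_atTop_nhds_zero_of_norm_lt_one (x := μ⁻¹)
      (by rw [norm_inv]; exact inv_lt_one_of_one_lt₀ hμ)).mul_const (L v).1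
    rwa [zero_mul] at this
  have h5 := (L.symm.continuous.tendsto (0, 0)).comp h4
  rwa [Prod.mk_zero_zero, map_zero] at h5

lemma contDiffAt_linearChart (hφ : φ ∈ IsManifold.maximalAtlas (𝓡 3) k M) {F : M → M}
    (hF : ContMDiff (𝓡 3) (𝓡 3) k F) {v : ℂ × ℝ} (hv : v ∈ (linearChart φ L).target)
    (hFv : F ((linearChart φ L).symm v) ∈ (linearChart φ L).source) :
    ContDiffAt ℝ k (fun v => linearChart φ L (F ((linearChart φ L).symm v))) v := by
  have hv' : L.symm v ∈ φ.target := hv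
  have hFv' : F (φ.symm (L.symm v)) ∈ φ.source := hFv
  have h1 : ContMDiffAt (𝓡 3) (𝓡 3) k φ.symm (L.symm v) :=
    (contMDiffOn_symm_of_mem_maximalAtlas hφ).contMDiffAt (φ.open_target.mem_nhds hv')
  have h2 : ContMDiffAt (𝓡 3) (𝓡 3) k φ (F (φ.symm (L.symm v))) :=
    (contMDiffOn_of_mem_maximalAtlas hφ).contMDiffAt (φ.open_source.mem_nhds hFv')
  have h3 : ContMDiffAt (𝓡 3) (𝓡 3) k (fun w => φ (F (φ.symm w))) (L.symm v) :=
    h2.comp (L.symm v) ((hF _).comp (L.symm v) h1)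
  have h4 : ContDiffAt ℝ k (fun w => φ (F (φ.symm w))) (L.symm v) := h3.contDiffAt
  exact L.contDiff.contDiffAt.comp v (h4.comp v L.symm.contDiff.contDiffAt)

/-- Points of `U(p)` on the same side of the local unstable manifold have heights of the same
sign. -/
lemma height_pos_of_mem_component (hf : IsLinearNear f p φ ε A)
    (hL : ∀ v, L (A v) = focusMap μ lam (L v)) (hμ : 1 < ‖μ‖) {x y : M}
    (hy : 0 < (linearChart φ L y).2)
    (hx : x ∈ connectedComponentIn (nbhd φ ε \ localUnstable φ ε A) y) :
    0 < (linearChart φ L x).2 := by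
  set Z := connectedComponentIn (nbhd φ ε \ localUnstable φ ε A) y with hZ
  have hsub : Z ⊆ nbhd φ ε \ localUnstable φ ε A := connectedComponentIn_subset _ _
  have hymem : y ∈ Z := by
    refine mem_connectedComponentIn ?_
    by_contra hcon
    rw [hZ, connectedComponentIn_eq_empty hcon] at hx
    exact hx
  have hcont : ContinuousOn (fun x => (linearChart φ L x).2) Z := by
    refine ((linearChart φ L).continuousOn.mono fun x hx => ?_).snd
    obtain ⟨v, hv, rfl⟩ := (hsub hx).1
    exact φ.map_target (hf.ball_subset hv)
  have hne : ∀ x ∈ Z, (linearChart φ L x).2 ≠ 0 := by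
    intro x hx h0
    obtain ⟨v, hv, rfl⟩ := (hsub hx).1
    rw [linearChart_apply, φ.right_inv (hf.ball_subset hv)] at h0
    exact (hsub hx).2 ⟨v, ⟨hv, mem_stableSet_symm_of_snd_eq_zero hL hμ h0⟩, rfl⟩
  by_contra hcon
  obtain ⟨w, hw, hw0⟩ := isPreconnected_connectedComponentIn.intermediate_value hx hymem hcont
    (show (0 : ℝ) ∈ Icc _ _ from ⟨not_lt.mp hcon, hy.le⟩)
  exact hne w hw hw0

/-- Positive association, read in the chart. -/
lemma eventually_height_pos (hf : IsLinearNear f p φ ε A)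
    (hL : ∀ v, L (A v) = focusMap μ lam (L v)) (hμ : 1 < ‖μ‖) (h0 : 0 < lam) (h1 : lam < 1)
    {N : ℕ} {t₀ : ℝ}
    (hpos : ∀ᶠ x in 𝓝[stableSheet f φ ε A N \ {q}] q,
      f.symm^[N] x ∈ connectedComponentIn (nbhd φ ε \ localUnstable φ ε A) (f^[N] q))
    (hqN : f^[N] q ∈ nbhd φ ε) (hq : linearChart φ L (f^[N] q) = (0, t₀)) (ht₀ : 0 < t₀) :
    ∀ᶠ t in 𝓝 t₀, t ≠ t₀ →
      0 < (linearChart φ L (f.symm^[N + N] ((linearChart φ L).symm (0, t)))).2 := by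
  have hΦ := isFocusChart_linearChart hf hL hμ h0 h1
  set Φ := linearChart φ L with hΦdef
  set U : Set (ℂ × ℝ) := L '' Metric.ball 0 ε with hU
  have hqU : f^[N] q ∈ Φ.source ∩ Φ ⁻¹' U := by
    rw [← hΦ.image_eq, linearChart_symm_image]; exact hqN
  have htU : ((0 : ℂ), t₀) ∈ U := hq ▸ hqU.2
  set γ : ℝ → M := fun t => f.symm^[N] (Φ.symm (0, t)) with hγ
  have hγ0 : γ t₀ = q := by
    simp only [hγ]; rw [← hq, Φ.left_inv hqU.1]; exact iterate_symm_apply f.toHomeomorph N q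
  have hline : Continuous (fun t : ℝ => ((0 : ℂ), t)) := by fun_prop
  have hγc : ContinuousAt γ t₀ :=
    (f.toHomeomorph.symm.continuous.iterate N).continuousAt.comp
      ((Φ.continuousAt_symm (hΦ.subset_target htU)).comp (f := fun t : ℝ => ((0 : ℂ), t))
        hline.continuousAt)
  have hev : ∀ᶠ t in 𝓝 t₀, ((0 : ℂ), t) ∈ U :=
    hline.continuousAt.eventually_mem (hΦ.isOpen.mem_nhds htU)
  have htend : Tendsto γ (𝓝[≠] t₀) (𝓝[stableSheet f φ ε A N \ {q}] q) := by
    refine tendsto_nhdsWithin_iff.mpr ⟨?_, ?_⟩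
    · have := hγc.tendsto; rw [hγ0] at this; exact this.mono_left nhdsWithin_le_nhds
    · filter_upwards [nhdsWithin_le_nhds hev, self_mem_nhdsWithin] with t ht hne
      refine ⟨⟨Φ.symm (0, t), ?_, rfl⟩, fun heq => hne ?_⟩
      · obtain ⟨v, hv, hvt⟩ := ht
        refine ⟨v, ⟨hv, mem_stableSet_of_fst_eq_zero hL h0 h1 (by rw [hvt])⟩, ?_⟩
        rw [← hvt, linearChart_symm_apply, L.symm_apply_apply]
      · have h3 : Φ.symm (0, t) = Φ.symm (0, t₀) :=
          f.symm.injective.iterate N ((show γ t = q from heq).trans hγ0.symm)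
        have h4 := Φ.symm.injOn (hΦ.subset_target ht) (hΦ.subset_target htU) h3
        exact congrArg Prod.snd h4
  have h5 := eventually_nhdsWithin_iff.mp (htend.eventually hpos)
  filter_upwards [h5] with t ht hne
  rw [Function.iterate_add_apply]
  exact height_pos_of_mem_component hf hL hμ (by rw [← hΦdef, hq]; exact ht₀) (ht hne)

/-- The backward transition `f ^ (-2N)` from `f ^ N q` to `f ^ (-N) q`, read in the chart. -/
lemma exists_isPositiveTransition (hk : 1 ≤ k) (hf : IsLinearNear f p φ ε A)
    (hL : ∀ v, L (A v) = focusMap μ lam (L v)) (hμ : 1 < ‖μ‖) (h0 : 0 < lam) (h1 : lam < 1)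
    {N : ℕ} {z₀ : ℂ} {t₀ : ℝ}
    (hpos : ∀ᶠ x in 𝓝[stableSheet f φ ε A N \ {q}] q,
      f.symm^[N] x ∈ connectedComponentIn (nbhd φ ε \ localUnstable φ ε A) (f^[N] q))
    (hqN : f^[N] q ∈ nbhd φ ε) (hq : linearChart φ L (f^[N] q) = (0, t₀)) (ht₀ : 0 < t₀)
    (hqN' : f.symm^[N] q ∈ nbhd φ ε) (hq' : linearChart φ L (f.symm^[N] q) = (z₀, 0))
    (hz₀ : z₀ ≠ 0) :
    ∃ G, IsPositiveTransition
      (fun v => linearChart φ L (f.symm^[N + N] ((linearChart φ L).symm v))) z₀ t₀ G := by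
  have hΦ := isFocusChart_linearChart hf hL hμ h0 h1
  have hheight := eventually_height_pos hf hL hμ h0 h1 hpos hqN hq ht₀
  set Φ := linearChart φ L with hΦdef
  have himg := linearChart_symm_image (φ := φ) (ε := ε) (L := L)
  have hs : f^[N] q ∈ Φ.source := hΦ.mem_source_of_mem (himg ▸ hqN)
  have hu : f.symm^[N] q ∈ Φ.source := hΦ.mem_source_of_mem (himg ▸ hqN')
  have hsymm : Φ.symm (0, t₀) = f^[N] q := by rw [← hq, Φ.left_inv hs]
  have hsymm' : Φ.symm (z₀, 0) = f.symm^[N] q := by rw [← hq', Φ.left_inv hu]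
  have hts : ((0 : ℂ), t₀) ∈ Φ.target := hq ▸ Φ.map_source hs
  have htu : (z₀, (0 : ℝ)) ∈ Φ.target := hq' ▸ Φ.map_source hu
  have hbs : f.symm^[N + N] (f^[N] q) = f.symm^[N] q := by
    rw [Function.iterate_add_apply]
    exact congrArg _ (iterate_symm_apply f.toHomeomorph N q)
  have hfs : f^[N + N] (f.symm^[N] q) = f^[N] q := by
    rw [Function.iterate_add_apply]
    exact congrArg _ (iterate_apply_symm f.toHomeomorph N q)
  set S : ℂ × ℝ → ℂ × ℝ := fun v => Φ (f.symm^[N + N] (Φ.symm v)) with hS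
  set T : ℂ × ℝ → ℂ × ℝ := fun v => Φ (f^[N + N] (Φ.symm v)) with hT
  have hS0 : S (0, t₀) = (z₀, 0) := by simp only [hS]; rw [hsymm, hbs, hq']
  have hT0 : T (z₀, 0) = (0, t₀) := by simp only [hT]; rw [hsymm', hfs, hq]
  have hSd : ContDiffAt ℝ k S (0, t₀) :=
    contDiffAt_linearChart hf.mem_maximalAtlas (f.symm.contMDiff.iterate _) hts
      (by rw [← hΦdef, hsymm, hbs]; exact hu)
  have hTd : ContDiffAt ℝ k T (z₀, 0) :=
    contDiffAt_linearChart hf.mem_maximalAtlas (f.contMDiff.iterate _) htu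
      (by rw [← hΦdef, hsymm', hfs]; exact hs)
  have hk0 : k ≠ 0 := (zero_lt_one.trans_le hk).ne'
  have hST : ∀ᶠ x in 𝓝 (z₀, (0 : ℝ)), S (T x) = x := by
    have hc : ContinuousAt (fun v => f^[N + N] (Φ.symm v)) (z₀, 0) :=
      (f.toHomeomorph.continuous.iterate _).continuousAt.comp (Φ.continuousAt_symm htu)
    filter_upwards [Φ.open_target.mem_nhds htu,
      hc.preimage_mem_nhds (Φ.open_source.mem_nhds (by rw [hsymm', hfs]; exact hs))] with x hx hx'
    simp only [hS, hT]
    rw [Φ.left_inv hx']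
    rw [show f.symm^[N + N] (f^[N + N] (Φ.symm x)) = Φ.symm x from
      iterate_symm_apply f.toHomeomorph _ _, Φ.right_inv hx]
  refine ⟨(ContinuousLinearMap.snd ℝ ℂ ℝ).comp (fderiv ℝ S (0, t₀)), hz₀, ht₀, hS0, ?_, ?_, ?_,
    hheight⟩
  · exact ((hSd.of_le hk).eventually (by simp)).mono fun v hv => hv.continuousAt
  · exact (ContinuousLinearMap.snd ℝ ℂ ℝ).hasStrictFDerivAt.comp _ (hSd.hasStrictFDerivAt hk0)
  · rw [← hT0]
    exact snd_fderiv_ne_zero (hTd.differentiableAt hk0) (by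
      rw [hT0]; exact hSd.differentiableAt hk0) hST

/-- The linear coordinates can be chosen such that the forward orbit of a given point of the stable
manifold has positive heights. -/
lemma exists_oriented_chart (hf : IsLinearNear f p φ ε A)
    (hL : ∀ v, L (A v) = focusMap μ lam (L v)) (hμ : 1 < ‖μ‖) (h0 : 0 < lam) (h1 : lam < 1)
    (hq : q ∈ stableSet f p) (hne : q ≠ p) :
    ∃ L' : E3 ≃L[ℝ] ℂ × ℝ, (∀ v, L' (A v) = focusMap μ lam (L' v)) ∧ ∃ N : ℕ, ∀ n ≥ N,
      f^[n] q ∈ nbhd φ ε ∧ ∃ t₀ > 0, linearChart φ L' (f^[n] q) = (0, t₀) := by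
  obtain ⟨N, t, ht, hN⟩ := (isFocusChart_linearChart hf hL hμ h0 h1).exists_stable_orbit hq hne
  rw [linearChart_symm_image] at hN
  rcases lt_or_gt_of_ne ht with hlt | hgt
  · refine ⟨L.trans ((ContinuousLinearEquiv.refl ℝ ℂ).prodCongr (ContinuousLinearEquiv.neg ℝ)),
      fun v => ?_, N, fun n hn => ?_⟩
    · simp [hL, focusMap]
    · obtain ⟨i, rfl⟩ := Nat.exists_eq_add_of_le hn
      refine ⟨(hN i).1, lam ^ i * -t, by have := neg_pos.mpr hlt; positivity, ?_⟩
      have h2 : L (φ (f^[N + i] q)) = (0, lam ^ i * t) := (hN i).2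
      rw [linearChart_apply]
      simp [h2]
  · refine ⟨L, hL, N, fun n hn => ?_⟩
    obtain ⟨i, rfl⟩ := Nat.exists_eq_add_of_le hn
    exact ⟨(hN i).1, lam ^ i * t, by positivity, (hN i).2⟩

/-- The itineraries of homoclinic orbits of a diffeomorphism with a positively associated homoclinic
tangency of a saddle-focus. -/
theorem IsSaddleFocusWithTangency.exists_return_profile {r θ : ℝ}
    (hf : IsSaddleFocusWithTangency f p q r θ lam) (hk : 1 ≤ k) :
    ∃ B ∈ 𝓝 p, ∀ W ∈ 𝓝 p, ∀ᶠ N in atTop, ∃ c : ℝ, ∀ δ > 0,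
      ∃ Vu ∈ 𝓝 (f.symm^[N + N] (f^[N] q)), ∃ Vs ∈ 𝓝 (f^[N] q), ∃ C > 0,
      (∀ n : ℕ, δ ≤ Real.cos (n * θ + c) →
        ¬ SingleReturn f.toHomeomorph (N + N) Vu Vs B n) ∧
      (∀ n m : ℕ, δ ≤ Real.cos (n * θ + c) → DoubleReturn f.toHomeomorph (N + N) Vu Vs B n m →
        (r ^ n)⁻¹ ≤ C * lam ^ m) ∧
      ∀ Vu' ∈ 𝓝 (f.symm^[N + N] (f^[N] q)), ∀ Vs' ∈ 𝓝 (f^[N] q), ∃ n₀ : ℕ,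
        (∀ n ≥ n₀, Real.cos (n * θ + c) ≤ -δ →
          SingleReturn f.toHomeomorph (N + N) Vu' Vs' W n) ∧
        (∀ n ≥ n₀, ∀ m ≥ n₀, Real.cos (m * θ + c) ≤ -δ → C * (r ^ n)⁻¹ ≤ lam ^ m →
          DoubleReturn f.toHomeomorph (N + N) Vu' Vs' W n m) := by
  obtain ⟨φ, ε, A, hlin, hA, htan, hpos⟩ := hf.exists_chart
  have hr := hf.one_lt
  have h0 := hf.lam_pos
  have h1 := hf.lam_lt
  set μ : ℂ := r * Complex.exp (θ * Complex.I) with hμ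
  have hμn : ‖μ‖ = r := by
    rw [hμ, norm_mul, Complex.norm_exp_ofReal_mul_I, mul_one, Complex.norm_real,
      Real.norm_of_nonneg (by linarith)]
  have hμ1 : 1 < ‖μ‖ := hμn ▸ hr
  have him : μ.im ≠ 0 := by
    rw [hμ, Complex.im_ofReal_mul, Complex.exp_ofReal_mul_I_im]
    refine mul_ne_zero (by linarith) fun hsin => ?_
    obtain ⟨m, hm⟩ := Real.sin_eq_zero_iff.mp hsin
    exact hf.angle_ne m hm.symm
  obtain ⟨L₀, hL₀⟩ := exists_linear_normal_form A hA him
  obtain ⟨L, hL, N₁, hN₁⟩ := exists_oriented_chart hlin hL₀ hμ1 h0 h1 htan.mem_stable htan.ne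
  have hΦ := isFocusChart_linearChart hlin hL hμ1 h0 h1
  have himg := linearChart_symm_image (φ := φ) (ε := ε) (L := L)
  set Φ := linearChart φ L with hΦdef
  obtain ⟨N₂, hN₂⟩ := hΦ.exists_unstable_orbit htan.mem_unstable htan.ne
  refine ⟨nbhd φ ε, himg ▸ hΦ.image_mem_nhds, fun W hW => ?_⟩
  obtain ⟨η, hη, hball⟩ : ∃ η > 0, Metric.ball (0 : ℂ × ℝ) η ⊆
      L '' Metric.ball 0 ε ∩ Φ.symm ⁻¹' W := by
    refine Metric.mem_nhds_iff.mp (inter_mem (hΦ.isOpen.mem_nhds hΦ.zero_mem)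
      ((Φ.continuousAt_symm (hΦ.subset_target hΦ.zero_mem)).preimage_mem_nhds ?_))
    rwa [← hΦ.map_self, Φ.left_inv hΦ.mem_source]
  have hΦp : Tendsto Φ (𝓝 p) (𝓝 0) := by
    have := (Φ.continuousAt hΦ.mem_source).tendsto; rwa [hΦ.map_self] at this
  filter_upwards [hpos, eventually_ge_atTop N₁, eventually_ge_atTop N₂,
    (hΦp.comp htan.mem_stable).eventually_mem (Metric.ball_mem_nhds _ hη),
    (hΦp.comp htan.mem_unstable).eventually_mem (Metric.ball_mem_nhds _ hη)]
    with N hN hNN₁ hNN₂ hsη huη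
  obtain ⟨hsU, t₀, ht₀, hst⟩ := hN₁ N hNN₁
  obtain ⟨huU, hu1, hu2⟩ := hN₂ N hNN₂
  have hbs : f.symm^[N + N] (f^[N] q) = f.symm^[N] q := by
    rw [Function.iterate_add_apply]
    exact congrArg _ (iterate_symm_apply f.toHomeomorph N q)
  obtain ⟨G, hG⟩ := exists_isPositiveTransition hk hlin hL hμ1 h0 h1 hN hsU hst ht₀
    (himg ▸ huU) (z₀ := (Φ (f.symm^[N] q)).1) (Prod.ext rfl hu2) hu1
  have hfinal := hΦ.exists_return_profile (W := W) (K := N + N) (qs := f^[N] q) hμ hr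
    (fun v hv => (hball hv).1) (fun v hv => (hball hv).2) (hΦ.mem_source_of_mem (himg ▸ hsU))
    (show f.symm^[N + N] (f^[N] q) ∈ Φ.source by rw [hbs]; exact hΦ.mem_source_of_mem huU) hst hsη
    (show Φ (f.symm^[N + N] (f^[N] q)) ∈ _ by rw [hbs]; exact huη) hG
  rw [himg] at hfinal
  exact hfinal

end Chart

end SaddleFocus

/-! ### Transfer by the conjugacy -/

theorem theoremA {M : Type*} [TopologicalSpace M] [T2Space M] [SecondCountableTopology M]
    [ChartedSpace SaddleFocus.E3 M] (k : WithTop ℕ∞) (hk : 3 ≤ k) [IsManifold (𝓡 3) k M]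
    (f₀ f₁ : M ≃ₘ^k⟮𝓡 3, 𝓡 3⟯ M) (p₀ p₁ q₀ q₁ : M) (r₀ r₁ θ₀ θ₁ lam₀ lam₁ : ℝ)
    (hf₀ : SaddleFocus.IsSaddleFocusWithTangency f₀ p₀ q₀ r₀ θ₀ lam₀)
    (hf₁ : SaddleFocus.IsSaddleFocusWithTangency f₁ p₁ q₁ r₁ θ₁ lam₁)
    (h : M ≃ₜ M) (hconj : ∀ x, h (f₀ x) = f₁ (h x)) (hp : h p₀ = p₁) (hq : h q₀ = q₁) :
    Real.log lam₀ / Real.log r₀ = Real.log lam₁ / Real.log r₁ ∧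
      ((∃ m : ℤ, θ₀ = θ₁ + m * (2 * Real.pi)) ∨ (∃ m : ℤ, θ₀ = -θ₁ + m * (2 * Real.pi))) := by
  have hk1 : 1 ≤ k := le_trans (by norm_num) hk
  obtain ⟨τ₀, hτ₀, hθτ₀⟩ := SaddleFocus.exists_reduced_angle hf₀.angle_ne
  obtain ⟨τ₁, hτ₁, hθτ₁⟩ := SaddleFocus.exists_reduced_angle hf₁.angle_ne
  -- each step of the two rotations exceeds `2d` and falls short of a half-turn by more than `2d`
  obtain ⟨d, hd, hd₀, hd₀', hd₁, hd₁'⟩ : ∃ d > 0, 2 * d < τ₀ ∧ 2 * d < Real.pi - τ₀ ∧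
      2 * d < τ₁ ∧ 2 * d < Real.pi - τ₁ := by
    have h1 : 0 < min (min τ₀ (Real.pi - τ₀)) (min τ₁ (Real.pi - τ₁)) :=
      lt_min (lt_min hτ₀.1 (sub_pos.mpr hτ₀.2)) (lt_min hτ₁.1 (sub_pos.mpr hτ₁.2))
    obtain ⟨d, hd, hlt⟩ := exists_between (half_pos h1)
    have h2 : 2 * d < min (min τ₀ (Real.pi - τ₀)) (min τ₁ (Real.pi - τ₁)) := by linarith
    rw [lt_min_iff, lt_min_iff, lt_min_iff] at h2
    exact ⟨d, hd, h2.1.1, h2.1.2, h2.2.1, h2.2.2⟩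
  have hδ : 0 < Real.sin d :=
    Real.sin_pos_of_pos_of_lt_pi hd (by linarith [hτ₀.2, Real.pi_pos])
  obtain ⟨B₀, hB₀, H₀⟩ := hf₀.exists_return_profile hk1
  obtain ⟨B₁, hB₁, H₁⟩ := hf₁.exists_return_profile hk1
  have hsc : Function.Semiconj h f₀ f₁ := hconj
  have hsc' : Function.Semiconj h.symm f₁ f₀ := fun x => by
    rw [Homeomorph.symm_apply_eq, hconj, h.apply_symm_apply]
  have hscs : Function.Semiconj h f₀.symm f₁.symm :=
    SaddleFocus.semiconj_symm (f := f₀.toHomeomorph) (g := f₁.toHomeomorph) hconj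
  set W : Set M := B₀ ∩ h ⁻¹' B₁ with hW
  have hWn : W ∈ 𝓝 p₀ := inter_mem hB₀ (h.continuous.continuousAt.preimage_mem_nhds (hp ▸ hB₁))
  have hback : ∀ {V : Set M} {x y : M}, h x = y → V ∈ 𝓝 x → h.symm ⁻¹' V ∈ 𝓝 y := by
    rintro V x _ rfl hV
    exact h.symm.continuous.continuousAt.preimage_mem_nhds (by rwa [h.symm_apply_apply])
  obtain ⟨N, hN₀, hN₁⟩ := ((H₀ W hWn).and (H₁ _ (hback hp hWn))).exists
  obtain ⟨c₀, hc₀⟩ := hN₀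
  obtain ⟨c₁, hc₁⟩ := hN₁
  obtain ⟨Vu₀, hVu₀, Vs₀, hVs₀, C₀, hC₀, nec₀, nec₀', suf₀⟩ := hc₀ _ hδ
  obtain ⟨Vu₁, hVu₁, Vs₁, hVs₁, C₁, hC₁, nec₁, nec₁', suf₁⟩ := hc₁ _ hδ
  have hqs : h (f₀^[N] q₀) = f₁^[N] q₁ := by rw [(hsc.iterate_right N).eq, hq]
  have hqu : h (f₀.symm^[N + N] (f₀^[N] q₀)) = f₁.symm^[N + N] (f₁^[N] q₁) := by
    rw [(hscs.iterate_right (N + N)).eq, hqs]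
  set Vu : Set M := Vu₀ ∩ h ⁻¹' Vu₁ with hVu
  set Vs : Set M := Vs₀ ∩ h ⁻¹' Vs₁ with hVs
  have hVun : Vu ∈ 𝓝 (f₀.symm^[N + N] (f₀^[N] q₀)) :=
    inter_mem hVu₀ (h.continuous.continuousAt.preimage_mem_nhds (by rwa [hqu]))
  have hVsn : Vs ∈ 𝓝 (f₀^[N] q₀) :=
    inter_mem hVs₀ (h.continuous.continuousAt.preimage_mem_nhds (by rwa [hqs]))
  obtain ⟨n₀, sing₀, doub₀⟩ := suf₀ Vu hVun Vs hVsn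
  obtain ⟨n₁, sing₁, doub₁⟩ := suf₁ _ (hback hqu hVun) _ (hback hqs hVsn)
  obtain ⟨e₀, he₀⟩ := SaddleFocus.exists_cos_phase hθτ₀ c₀
  obtain ⟨e₁, he₁⟩ := SaddleFocus.exists_cos_phase hθτ₁ c₁
  constructor
  · refine le_antisymm (SaddleFocus.log_div_log_le hd hd₀ hd₀' hd₁ hd₁' hf₀.one_lt hf₁.one_lt
      hf₀.lam_pos hf₀.lam_lt hf₁.lam_pos hf₁.lam_lt hC₀ hC₁ (n₀ := n₀) (c₀ := e₀) (c₁ := e₁) ?_)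
      (SaddleFocus.log_div_log_le hd hd₁ hd₁' hd₀ hd₀' hf₁.one_lt hf₀.one_lt
      hf₁.lam_pos hf₁.lam_lt hf₀.lam_pos hf₀.lam_lt hC₁ hC₀ (n₀ := n₁) (c₀ := e₁) (c₁ := e₀) ?_)
    · intro n hn m hm hcm hnm hcn
      exact nec₁' n m (by rwa [he₁]) ((doub₀ n hn m hm (by rwa [he₀]) hnm).map hsc
        (fun x hx => hx.2) (fun x hx => hx.2) (fun x hx => hx.2))
    · intro n hn m hm hcm hnm hcn
      exact nec₀' n m (by rwa [he₀]) ((doub₁ n hn m hm (by rwa [he₁]) hnm).map hsc'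
        (fun x hx => hx.1) (fun x hx => hx.1) (fun x hx => hx.1))
  · have hττ : τ₀ = τ₁ := by
      refine SaddleFocus.angle_eq_of_sign_pattern (n₀ := max n₀ n₁) (c₀ := e₀) (c₁ := e₁)
        (b := SaddleFocus.SingleReturn f₀.toHomeomorph (N + N) Vu Vs W) hd hd₀ hd₀' hd₁ hd₁'
        ?_ ?_ ?_ ?_
      · intro n _ hcos hb
        exact nec₀ n (by rwa [he₀]) (hb.map (h := id) (fun _ => rfl)
          (fun x hx => hx.1) (fun x hx => hx.1) (fun x hx => hx.1))
      · intro n hn hcos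
        exact sing₀ n ((le_max_left _ _).trans hn) (by rwa [he₀])
      · intro n _ hcos hb
        exact nec₁ n (by rwa [he₁]) (hb.map hsc
          (fun x hx => hx.2) (fun x hx => hx.2) (fun x hx => hx.2))
      · intro n hn hcos
        exact (sing₁ n ((le_max_right _ _).trans hn) (by rwa [he₁])).map hsc'
          (mapsTo_preimage _ _) (mapsTo_preimage _ _) (mapsTo_preimage _ _)
    subst hττ
    rcases hθτ₀ with ⟨m, hm⟩ | ⟨m, hm⟩ <;> rcases hθτ₁ with ⟨l, hl⟩ | ⟨l, hl⟩
    · exact Or.inl ⟨m - l, by push_cast; linarith⟩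
    · exact Or.inr ⟨m + l, by push_cast; linarith⟩
    · exact Or.inr ⟨m + l, by push_cast; linarith⟩
    · exact Or.inl ⟨m - l, by push_cast; linarith⟩
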